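/- Let $L>0$ and let $q\in L_2[0,L]$ be complex valued. For $\rho\in\mathbb{C}$ and $h\in\mathbb{C}$ let $S(\rho,\cdot)$ and $\phi(\rho,\cdot)$ be the solutions on $[0,L]$ of $$-y''+q(x)y=\rho^2y$$ (that is, $y\in C^1[0,L]$, $y'$ is absolutely continuous, and the equation holds almost everywhere) with $S(\rho,0)=0$, $S'(\rho,0)=1$ and $\phi(\rho,0)=1$, $\phi'(\rho,0)=h$. Transmutation kernels of these solutions are functions $\mathcal{S}(x,t)$ and $\mathcal{G}(x,t)$, $0\le t\le x\le L$, continuous in $t\in[0,x]$ for each $x$, such that for all $\rho\in\mathbb{C}$ and all $x\in[0,L]$ $$S(\rho,x)=\frac{\sin(\rho x)}{\rho}+\int_0^x\mathcal{S}(x,t)\frac{\sin(\rho t)}{\rho}\,dt,\qquad \phi(\rho,x)=\cos(\rho x)+\int_0^x\mathcal{G}(x,t)\cos(\rho t)\,dt,$$ where $\sin(\rho t)/\rho$ is read as $t$ for $\rho=0$. Then such kernels exist, and for every $x\in(0,L]$ they admit the series representations $$\mathcal{S}(x,t)=\sum_{n=0}^{\infty}\frac{b_n(x)}{x}\sin\left(\frac{2n+1}{2x}\pi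 t\right),\qquad \mathcal{G}(x,t)=\sum_{n=0}^{\infty}\frac{\mathfrak{g}_n(x)}{x}\cos\left(\frac{n\pi t}{x}\right),$$ where $$b_n(x)=2\int_0^x\mathcal{S}(x,t)\sin\left(\frac{2n+1}{2x}\pi t\right)dt\ (n\ge0),\quad \mathfrak{g}_0(x)=\int_0^x\mathcal{G}(x,t)\,dt,\quad \mathfrak{g}_n(x)=2\int_0^x\mathcal{G}(x,t)\cos\left(\frac{n\pi t}{x}\right)dt\ (n\ge1).$$ Both series converge absolutely for each $t\in[0,x]$ and uniformly with respect to $t\in[0,x]$. -/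

import Mathlib

open MeasureTheory

namespace SturmLiouville

/-- `y` is the solution on `[0, L]` of `-y'' + q y = ρ² y`, `y(0) = a`, `y'(0) = b`, for an
integrable potential `q` (Carathéodory sense): `y` is continuously differentiable on `[0, L]`, its
derivative `y'` is absolutely continuous there, and the equation holds almost everywhere. -/
def IsCauchySolution (L : ℝ) (q : ℝ → ℂ) (ρ a b : ℂ) (y : ℝ → ℂ) : Prop :=
  ∃ y' y'' : ℝ → ℂ,
    (∀ x ∈ Set.Icc 0 L, HasDerivWithinAt y (y' x) (Set.Icc 0 L) x) ∧
    AbsolutelyContinuousOnInterval y' 0 L ∧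
    (∀ᵐ x ∂(volume.restrict (Set.Ioo 0 L)),
      HasDerivAt y' (y'' x) x ∧ -y'' x + q x * y x = ρ ^ 2 * y x) ∧
    y 0 = a ∧ y' 0 = b

open Classical in
/-- The entire function `ρ ↦ sin (ρ t) / ρ`, with its value `t` at `ρ = 0`. -/
noncomputable def sinDiv (ρ : ℂ) (t : ℝ) : ℂ :=
  if ρ = 0 then (t : ℂ) else Complex.sin (ρ * t) / ρ

/-- `K`, considered on `0 ≤ t ≤ x ≤ L`, is the transmutation kernel `𝒮` of the solution `S(ρ, x)`
with `S(ρ, 0) = 0`, `S'(ρ, 0) = 1`: each `K(x, ·)` is continuous on `[0, x]` and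
`S(ρ, x) = sin(ρx)/ρ + ∫₀ˣ K(x,t) sin(ρt)/ρ dt` for all complex `ρ`. -/
def IsKernelS (L : ℝ) (q : ℝ → ℂ) (K : ℝ → ℝ → ℂ) : Prop :=
  (∀ x ∈ Set.Icc 0 L, ContinuousOn (K x) (Set.Icc 0 x)) ∧
  ∀ ρ : ℂ, ∃ S : ℝ → ℂ, IsCauchySolution L q ρ 0 1 S ∧
    ∀ x ∈ Set.Icc 0 L, S x = sinDiv ρ x + ∫ t in (0 : ℝ)..x, K x t * sinDiv ρ t

/-- `K`, considered on `0 ≤ t ≤ x ≤ L`, is the transmutation kernel `𝒢` of the solution `φ(ρ, x)`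
with `φ(ρ, 0) = 1`, `φ'(ρ, 0) = h`: each `K(x, ·)` is continuous on `[0, x]` and
`φ(ρ, x) = cos(ρx) + ∫₀ˣ K(x,t) cos(ρt) dt` for all complex `ρ`. -/
def IsKernelG (L : ℝ) (q : ℝ → ℂ) (h : ℂ) (K : ℝ → ℝ → ℂ) : Prop :=
  (∀ x ∈ Set.Icc 0 L, ContinuousOn (K x) (Set.Icc 0 x)) ∧
  ∀ ρ : ℂ, ∃ φ : ℝ → ℂ, IsCauchySolution L q ρ 1 h φ ∧
    ∀ x ∈ Set.Icc 0 L,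
      φ x = Complex.cos (ρ * x) + ∫ t in (0 : ℝ)..x, K x t * Complex.cos (ρ * t)

/-- `b_n(x) = 2 ∫₀ˣ K(x,t) sin((2n+1)πt/(2x)) dt`; thus `b_n(x)/x` is the Fourier coefficient of
`K(x, ·)` for the orthogonal basis `sin((2n+1)πt/(2x))` of `L²(0, x)`. -/
noncomputable def coeffB (K : ℝ → ℝ → ℂ) (n : ℕ) (x : ℝ) : ℂ :=
  2 * ∫ t in (0 : ℝ)..x, K x t * (Real.sin ((2 * n + 1) * Real.pi * t / (2 * x)) : ℂ)

/-- `g_0(x) = ∫₀ˣ K(x,t) dt` and `g_n(x) = 2 ∫₀ˣ K(x,t) cos(nπt/x) dt` for `n ≥ 1`; thus `g_n(x)/x`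
is the Fourier coefficient of `K(x, ·)` for the orthogonal basis `cos(nπt/x)` of `L²(0, x)`. -/
noncomputable def coeffG (K : ℝ → ℝ → ℂ) (n : ℕ) (x : ℝ) : ℂ :=
  (if n = 0 then 1 else 2) *
    ∫ t in (0 : ℝ)..x, K x t * (Real.cos (n * Real.pi * t / x) : ℂ)

/-- On the set `s`, the series of functions `∑ u_n` converges to `f` absolutely (at each point of
`s`) and uniformly. -/
def SumsAbsolutelyUniformlyOn (u : ℕ → ℝ → ℂ) (f : ℝ → ℂ) (s : Set ℝ) : Prop :=
  (∀ t ∈ s, Summable fun n => ‖u n t‖) ∧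
  TendstoUniformlyOn (fun (N : ℕ) t => ∑ n ∈ Finset.range N, u n t) f Filter.atTop s

end SturmLiouville

namespace SturmLiouville

open Set Filter Topology

/-! ### Absolutely continuous complex functions -/

/-! Existence of the kernels. A Cauchy problem is equivalent to the Volterra equation `y(x) = m(x) +
∫₀ˣ sinDiv ρ (x-t) q(t) y(t) dt` with free term `m = a cos(ρx) + b sin(ρx)/ρ`. Multiplying such an
`m` by `sinDiv ρ p` amounts to integrating it over a window of radius `p` (`sinDiv_mul_mode`). Hence
`m + ∫₋ₓˣ K(x,r) m(r) dr` solves the equation as soon as `K` satisfies an integral equation of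
Goursat type that contains neither `ρ` nor `a`, `b` (`volterra_of_goursat`). That equation is solved
by contraction in an exponentially weighted sup norm (`exists_goursat_fixedPoint`). Folding `[-x,x]`
onto `[0,x]` yields `𝒮` from the odd part of `K`, and `𝒢` from the even part together with an
integrated odd part.

Series. At the frequencies `ρ_n` of the trigonometric system, the defining identity of a kernel
turns its Fourier coefficients into values of the Cauchy solution minus its free term. The
first-order Volterra asymptotics (`norm_volterra_sub_le`) make these values `F_n/ρ_n + O(ρ_n⁻²)`,
where `F_n` is the modulus of a Fourier sine coefficient of `q` on `[0,x]`. Since `q ∈ L²`, `F` is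
square summable, so the coefficients are absolutely summable. The series then has a continuous sum
with the same coefficients as the kernel, and completeness of the system identifies the two
(`sumsAbsolutelyUniformlyOn_of_orthogonal`). This half uses only the defining property of a kernel,
hence applies to every kernel and not just to the one constructed. Square integrability matters only
for `F`; the rest needs `q` integrable. -/

theorem absolutelyContinuousOnInterval_primitive {f : ℝ → ℂ} {a b c : ℝ}
    (hf : IntervalIntegrable f volume a b) (hc : c ∈ uIcc a b) :
    AbsolutelyContinuousOnInterval (fun x => ∫ v in c..x, f v) a b := by
  -- Increments of the primitive of `f` are dominated by those of the real primitive of `‖f‖`.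
  have hr := (hf.norm.absolutelyContinuousOnInterval_intervalIntegral hc)
  rw [absolutelyContinuousOnInterval_iff] at hr ⊢
  intro ε hε
  obtain ⟨δ, hδ, H⟩ := hr ε hε
  refine ⟨δ, hδ, fun E hE hlt => lt_of_le_of_lt ?_ (H E hE hlt)⟩
  refine Finset.sum_le_sum fun i hi => ?_
  obtain ⟨h1, h2⟩ := hE.1 i hi
  have I1 : IntervalIntegrable f volume c (E.2 i).1 := hf.mono_set (uIcc_subset_uIcc hc h1)
  have I2 : IntervalIntegrable f volume c (E.2 i).2 := hf.mono_set (uIcc_subset_uIcc hc h2)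
  rw [dist_eq_norm, dist_eq_norm, intervalIntegral.integral_interval_sub_left I1 I2,
    intervalIntegral.integral_interval_sub_left I1.norm I2.norm]
  exact intervalIntegral.norm_integral_le_abs_integral_norm

/-- Subtracting the primitive of `f'` leaves an absolutely continuous function with zero derivative
almost everywhere, hence a constant. -/
theorem integral_eq_sub_of_absolutelyContinuous {f f' : ℝ → ℂ} {a b : ℝ} (hab : a ≤ b)
    (hf : AbsolutelyContinuousOnInterval f a b) (hi : IntervalIntegrable f' volume a b)
    (hd : ∀ᵐ x, x ∈ Ioo a b → HasDerivAt f (f' x) x) :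
    ∫ x in a..b, f' x = f b - f a := by
  have hp := absolutelyContinuousOnInterval_primitive hi left_mem_uIcc
  have hg : AbsolutelyContinuousOnInterval (fun x => f x - ∫ v in a..x, f' v) a b := hf.fun_sub hp
  obtain ⟨C, hC⟩ := hg.const_of_ae_hasDerivAt_zero (by
    have ha : ∀ᵐ x : ℝ, x ≠ a := by simp [ae_iff, measure_singleton]
    have hb : ∀ᵐ x : ℝ, x ≠ b := by simp [ae_iff, measure_singleton]
    filter_upwards [hd, hi.ae_hasDerivAt_integral, ha, hb] with x h1 h2 h3 h4 hx
    have hx' := hx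
    rw [uIcc_of_le hab] at hx'
    have := (h1 ⟨lt_of_le_of_ne hx'.1 h3.symm, lt_of_le_of_ne hx'.2 h4⟩).sub
      (h2 hx a left_mem_uIcc)
    exact this.congr_deriv (sub_self _))
  have h1 := hC a left_mem_uIcc
  have h2 := hC b right_mem_uIcc
  simp only [intervalIntegral.integral_same, sub_zero] at h1
  rw [← h1] at h2
  linear_combination -h2

/-! ### The functions `sin (ρ t) / ρ` and `cos (ρ t)` -/

theorem mul_sinDiv (ρ : ℂ) (t : ℝ) : ρ * sinDiv ρ t = Complex.sin (ρ * t) := by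
  unfold sinDiv
  split_ifs with h
  · simp [h]
  · field_simp

@[simp] theorem sinDiv_zero_right (ρ : ℂ) : sinDiv ρ 0 = 0 := by simp [sinDiv]

theorem sinDiv_neg (ρ : ℂ) (t : ℝ) : sinDiv ρ (-t) = -sinDiv ρ t := by
  unfold sinDiv
  split_ifs with h
  · simp
  · simp [neg_div]

theorem sinDiv_add (ρ : ℂ) (x t : ℝ) :
    sinDiv ρ (x + t) = sinDiv ρ x * Complex.cos (ρ * t) + Complex.cos (ρ * x) * sinDiv ρ t := by
  unfold sinDiv
  split_ifs with h
  · simp [h]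
  · push_cast
    rw [mul_add, Complex.sin_add]
    field_simp

theorem cos_mul_neg (ρ : ℂ) (t : ℝ) : Complex.cos (ρ * ((-t : ℝ) : ℂ)) = Complex.cos (ρ * t) := by
  simp

theorem sinDiv_sub (ρ : ℂ) (x t : ℝ) :
    sinDiv ρ (x - t) = sinDiv ρ x * Complex.cos (ρ * t) - Complex.cos (ρ * x) * sinDiv ρ t := by
  rw [sub_eq_add_neg, sinDiv_add, sinDiv_neg, cos_mul_neg]
  ring

theorem cos_mul_add (ρ : ℂ) (x t : ℝ) : Complex.cos (ρ * ((x + t : ℝ) : ℂ)) =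
    Complex.cos (ρ * x) * Complex.cos (ρ * t) - ρ ^ 2 * (sinDiv ρ x * sinDiv ρ t) := by
  push_cast
  rw [mul_add, Complex.cos_add, ← mul_sinDiv, ← mul_sinDiv]
  ring

theorem cos_mul_sub (ρ : ℂ) (x t : ℝ) : Complex.cos (ρ * ((x - t : ℝ) : ℂ)) =
    Complex.cos (ρ * x) * Complex.cos (ρ * t) + ρ ^ 2 * (sinDiv ρ x * sinDiv ρ t) := by
  rw [sub_eq_add_neg, cos_mul_add, sinDiv_neg, cos_mul_neg]
  ring

theorem cos_sq_add_sinDiv_sq (ρ : ℂ) (x : ℝ) :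
    Complex.cos (ρ * x) ^ 2 + ρ ^ 2 * sinDiv ρ x ^ 2 = 1 := by
  have := cos_mul_sub ρ x x
  simp only [sub_self, Complex.ofReal_zero, mul_zero, Complex.cos_zero] at this
  rw [this]
  ring

theorem hasDerivAt_cos_mul (ρ : ℂ) (t : ℝ) :
    HasDerivAt (fun t : ℝ => Complex.cos (ρ * t)) (-ρ ^ 2 * sinDiv ρ t) t := by
  have h : HasDerivAt (fun t : ℝ => ρ * (t : ℂ)) ρ t := by
    simpa using (Complex.ofRealCLM.hasDerivAt (x := t)).const_mul ρ
  have := (Complex.hasDerivAt_cos (ρ * t)).comp t h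
  refine this.congr_deriv ?_
  rw [← mul_sinDiv]
  ring

theorem hasDerivAt_sinDiv (ρ : ℂ) (t : ℝ) :
    HasDerivAt (sinDiv ρ) (Complex.cos (ρ * t)) t := by
  by_cases hρ : ρ = 0
  · have : sinDiv ρ = fun t : ℝ => (t : ℂ) := by
      funext t; simp [sinDiv, hρ]
    rw [this, hρ]
    exact (Complex.ofRealCLM.hasDerivAt (x := t)).congr_deriv (by simp)
  · have : sinDiv ρ = fun t : ℝ => Complex.sin (ρ * t) / ρ := by
      funext t; simp [sinDiv, hρ]
    rw [this]
    have h : HasDerivAt (fun t : ℝ => ρ * (t : ℂ)) ρ t := by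
      simpa using (Complex.ofRealCLM.hasDerivAt (x := t)).const_mul ρ
    have := ((Complex.hasDerivAt_sin (ρ * t)).comp t h).div_const ρ
    refine this.congr_deriv ?_
    field_simp

theorem continuous_sinDiv (ρ : ℂ) : Continuous (sinDiv ρ) :=
  continuous_iff_continuousAt.2 fun t => (hasDerivAt_sinDiv ρ t).continuousAt

theorem continuous_cos_mul (ρ : ℂ) : Continuous fun t : ℝ => Complex.cos (ρ * t) := by fun_prop

theorem absolutelyContinuousOnInterval_of_hasDerivAt {f f' : ℝ → ℂ}
    (hf : ∀ x, HasDerivAt f (f' x) x) (hf' : Continuous f') (a b : ℝ) :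
    AbsolutelyContinuousOnInterval f a b := by
  refine ContDiffOn.absolutelyContinuousOnInterval (ContDiff.contDiffOn ?_)
  rw [contDiff_one_iff_deriv]
  refine ⟨fun x => (hf x).differentiableAt, ?_⟩
  rwa [funext fun x => (hf x).deriv]

theorem absolutelyContinuous_sinDiv (ρ : ℂ) (a b : ℝ) :
    AbsolutelyContinuousOnInterval (sinDiv ρ) a b :=
  absolutelyContinuousOnInterval_of_hasDerivAt (hasDerivAt_sinDiv ρ) (by fun_prop) a b

theorem absolutelyContinuous_cos_mul (ρ : ℂ) (a b : ℝ) :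
    AbsolutelyContinuousOnInterval (fun t : ℝ => Complex.cos (ρ * t)) a b :=
  absolutelyContinuousOnInterval_of_hasDerivAt (hasDerivAt_cos_mul ρ)
    (continuous_const.mul (continuous_sinDiv ρ)) a b

/-! ### Cauchy solutions and the Volterra integral equation -/

theorem absolutelyContinuousOnInterval_mul {f g : ℝ → ℂ} {a b : ℝ}
    (hf : AbsolutelyContinuousOnInterval f a b) (hg : AbsolutelyContinuousOnInterval g a b) :
    AbsolutelyContinuousOnInterval (fun x => f x * g x) a b :=
  hf.fun_smul hg

theorem absolutelyContinuousOnInterval_of_hasDerivWithinAt {f f' : ℝ → ℂ} {a b : ℝ} (hab : a ≤ b)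
    (hf : ∀ x ∈ Icc a b, HasDerivWithinAt f (f' x) (Icc a b) x) (hf' : ContinuousOn f' (Icc a b)) :
    AbsolutelyContinuousOnInterval f a b := by
  obtain ⟨C, hC⟩ := isCompact_Icc.exists_bound_of_continuousOn hf'
  have : LipschitzOnWith (Real.toNNReal C) f (uIcc a b) := by
    rw [uIcc_of_le hab]
    refine (convex_Icc a b).lipschitzOnWith_of_nnnorm_hasDerivWithin_le hf fun x hx => ?_
    rw [← norm_toNNReal]
    exact Real.toNNReal_le_toNNReal (hC x hx)
  exact this.absolutelyContinuousOnInterval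

theorem IsCauchySolution.continuousOn {L : ℝ} {q : ℝ → ℂ} {ρ a b : ℂ} {y : ℝ → ℂ}
    (hy : IsCauchySolution L q ρ a b y) : ContinuousOn y (Icc 0 L) := by
  obtain ⟨y', -, h, -⟩ := hy
  exact fun x hx => (h x hx).continuousWithinAt

/-- The function `t ↦ sinDiv ρ (x-t) y'(t) + cos(ρ(x-t)) y(t)` has derivative `sinDiv ρ (x-t) q(t)
y(t)`, equals `y x` at `t = x`, and equals the free term at `t = 0`. -/
theorem IsCauchySolution.eq_integral {L : ℝ} (hL : 0 ≤ L) {q : ℝ → ℂ}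
    (hq : IntervalIntegrable q volume 0 L) {ρ a b : ℂ} {y : ℝ → ℂ}
    (hy : IsCauchySolution L q ρ a b y) {x : ℝ} (hx : x ∈ Icc 0 L) :
    y x = a * Complex.cos (ρ * x) + b * sinDiv ρ x +
      ∫ t in (0 : ℝ)..x, sinDiv ρ (x - t) * (q t * y t) := by
  have hyc := hy.continuousOn
  obtain ⟨y', y'', hd, hac, hae, h0, h0'⟩ := hy
  have hsub : uIcc 0 x ⊆ uIcc 0 L := by
    rw [uIcc_of_le hx.1, uIcc_of_le hL]; exact Icc_subset_Icc le_rfl hx.2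
  have hyac : AbsolutelyContinuousOnInterval y 0 x :=
    (absolutelyContinuousOnInterval_of_hasDerivWithinAt hL hd
      (by simpa [uIcc_of_le hL] using hac.continuousOn)).mono hsub
  have hs : ∀ t, HasDerivAt (fun t => sinDiv ρ (x - t)) (-Complex.cos (ρ * ((x - t : ℝ) : ℂ))) t := by
    intro t
    have := (hasDerivAt_sinDiv ρ (x - t)).scomp t ((hasDerivAt_id t).const_sub x)
    simpa [Function.comp_def] using this
  have hc : ∀ t, HasDerivAt (fun t : ℝ => Complex.cos (ρ * ((x - t : ℝ) : ℂ)))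
      (ρ ^ 2 * sinDiv ρ (x - t)) t := by
    intro t
    have := (hasDerivAt_cos_mul ρ (x - t)).scomp t ((hasDerivAt_id t).const_sub x)
    simpa [Function.comp_def] using this
  have hcs : Continuous fun t => sinDiv ρ (x - t) :=
    (continuous_sinDiv ρ).comp (continuous_const.sub continuous_id)
  have hac1 : AbsolutelyContinuousOnInterval
      (fun t => sinDiv ρ (x - t) * y' t + Complex.cos (ρ * ((x - t : ℝ) : ℂ)) * y t) 0 x :=
    (absolutelyContinuousOnInterval_mul
      (absolutelyContinuousOnInterval_of_hasDerivAt hs (by fun_prop) 0 x) (hac.mono hsub)).fun_add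
      (absolutelyContinuousOnInterval_mul
      (absolutelyContinuousOnInterval_of_hasDerivAt hc (continuous_const.mul hcs) 0 x) hyac)
  have hi : IntervalIntegrable (fun t => sinDiv ρ (x - t) * (q t * y t)) volume 0 x := by
    refine ((hq.mono_set hsub).mul_continuousOn ?_).continuousOn_mul hcs.continuousOn
    rw [uIcc_of_le hx.1]
    exact hyc.mono (Icc_subset_Icc le_rfl hx.2)
  rw [integral_eq_sub_of_absolutelyContinuous hx.1 hac1 hi]
  · simp [h0, h0']; ring
  · rw [ae_restrict_iff' measurableSet_Ioo] at hae
    filter_upwards [hae] with t ht htx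
    have htL : t ∈ Ioo 0 L := ⟨htx.1, htx.2.trans_le hx.2⟩
    obtain ⟨h1, h2⟩ := ht htL
    have h3 := (hd t (Ioo_subset_Icc_self htL)).hasDerivAt (Icc_mem_nhds htL.1 htL.2)
    refine (((hs t).mul h1).add ((hc t).mul h3)).congr_deriv ?_
    linear_combination (-sinDiv ρ (x - t)) * h2

theorem isCauchySolution_of_eq_integral {L : ℝ} (hL : 0 ≤ L) {q : ℝ → ℂ}
    (hq : IntervalIntegrable q volume 0 L) {ρ a b : ℂ} {y : ℝ → ℂ}
    (hyc : ContinuousOn y (Icc 0 L))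
    (hy : ∀ x ∈ Icc 0 L, y x = a * Complex.cos (ρ * x) + b * sinDiv ρ x +
      ∫ t in (0 : ℝ)..x, sinDiv ρ (x - t) * (q t * y t)) :
    IsCauchySolution L q ρ a b y := by
  have hI : ∀ g : ℝ → ℂ, Continuous g →
      IntervalIntegrable (fun t => g t * (q t * y t)) volume 0 L := fun g hg =>
    (hq.mul_continuousOn (by rwa [uIcc_of_le hL])).continuousOn_mul hg.continuousOn
  set A : ℝ → ℂ := fun x => ∫ t in (0 : ℝ)..x, Complex.cos (ρ * t) * (q t * y t) with hA
  set B : ℝ → ℂ := fun x => ∫ t in (0 : ℝ)..x, sinDiv ρ t * (q t * y t) with hB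
  have hIA := hI _ (continuous_cos_mul ρ)
  have hIB := hI _ (continuous_sinDiv ρ)
  have hAac : AbsolutelyContinuousOnInterval A 0 L :=
    absolutelyContinuousOnInterval_primitive hIA left_mem_uIcc
  have hBac : AbsolutelyContinuousOnInterval B 0 L :=
    absolutelyContinuousOnInterval_primitive hIB left_mem_uIcc
  have hAd : ∀ᵐ x, x ∈ Ioo 0 L → HasDerivAt A (Complex.cos (ρ * x) * (q x * y x)) x := by
    filter_upwards [hIA.ae_hasDerivAt_integral] with x h hx
    exact h (by rw [uIcc_of_le hL]; exact Ioo_subset_Icc_self hx) 0 left_mem_uIcc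
  have hBd : ∀ᵐ x, x ∈ Ioo 0 L → HasDerivAt B (sinDiv ρ x * (q x * y x)) x := by
    filter_upwards [hIB.ae_hasDerivAt_integral] with x h hx
    exact h (by rw [uIcc_of_le hL]; exact Ioo_subset_Icc_self hx) 0 left_mem_uIcc
  have hac_c := absolutelyContinuous_cos_mul ρ 0 L
  have hac_s := absolutelyContinuous_sinDiv ρ 0 L
  -- Variation of constants: the subtraction formula splits the convolution into `A` and `B`. In
  -- `z'` the contributions of `A'` and `B'` cancel, which leaves `v`.
  set z : ℝ → ℂ := fun x => Complex.cos (ρ * x) * (a - B x) + sinDiv ρ x * (b + A x) with hz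
  set v : ℝ → ℂ := fun x => Complex.cos (ρ * x) * (b + A x) - ρ ^ 2 * (sinDiv ρ x * (a - B x))
    with hv
  have hconst : ∀ k : ℂ, AbsolutelyContinuousOnInterval (fun _ => k) 0 L := fun k =>
    absolutelyContinuousOnInterval_of_hasDerivAt (f' := fun _ => 0)
      (fun x => hasDerivAt_const x k) continuous_const 0 L
  have hyz : ∀ x ∈ Icc 0 L, y x = z x := by
    intro x hx
    have hsub : uIcc 0 x ⊆ uIcc 0 L := by
      rw [uIcc_of_le hx.1, uIcc_of_le hL]; exact Icc_subset_Icc le_rfl hx.2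
    have : ∫ t in (0 : ℝ)..x, sinDiv ρ (x - t) * (q t * y t) =
        sinDiv ρ x * A x - Complex.cos (ρ * x) * B x := by
      rw [hA, hB]
      simp only
      rw [← intervalIntegral.integral_const_mul, ← intervalIntegral.integral_const_mul,
        ← intervalIntegral.integral_sub ((hIA.mono_set hsub).const_mul _)
          ((hIB.mono_set hsub).const_mul _)]
      refine intervalIntegral.integral_congr fun t _ => ?_
      simp only [sinDiv_sub]
      ring
    rw [hy x hx, this, hz]
    ring
  have hzac : AbsolutelyContinuousOnInterval z 0 L :=
    (absolutelyContinuousOnInterval_mul hac_c ((hconst a).fun_sub hBac)).fun_add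
      (absolutelyContinuousOnInterval_mul hac_s ((hconst b).fun_add hAac))
  have hvac : AbsolutelyContinuousOnInterval v 0 L :=
    (absolutelyContinuousOnInterval_mul hac_c ((hconst b).fun_add hAac)).fun_sub
      (absolutelyContinuousOnInterval_mul (hconst _)
        (absolutelyContinuousOnInterval_mul hac_s ((hconst a).fun_sub hBac)))
  have hvc : ContinuousOn v (Icc 0 L) := by simpa [uIcc_of_le hL] using hvac.continuousOn
  have hzd : ∀ᵐ x, x ∈ Ioo 0 L → HasDerivAt z (v x) x := by
    filter_upwards [hAd, hBd] with x h1 h2 hx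
    refine (((hasDerivAt_cos_mul ρ x).mul ((h2 hx).const_sub a)).add
      ((hasDerivAt_sinDiv ρ x).mul ((h1 hx).const_add b))).congr_deriv ?_
    rw [hv]
    ring
  -- `A` and `B` are differentiable only almost everywhere. Writing `z` as the primitive of the
  -- continuous function `v` makes it differentiable at every point.
  have hzint : ∀ x ∈ Icc 0 L, z x = z 0 + ∫ t in (0 : ℝ)..x, v t := by
    intro x hx
    have hsub : uIcc 0 x ⊆ uIcc 0 L := by
      rw [uIcc_of_le hx.1, uIcc_of_le hL]; exact Icc_subset_Icc le_rfl hx.2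
    rw [integral_eq_sub_of_absolutelyContinuous hx.1 (hzac.mono hsub)
      ((hvac.mono hsub).continuousOn.intervalIntegrable)]
    · ring
    · filter_upwards [hzd] with t ht htx
      exact ht ⟨htx.1, htx.2.trans_le hx.2⟩
  refine ⟨v, fun x => (q x - ρ ^ 2) * y x, ?_, hvac, ?_, ?_, ?_⟩
  · intro x hx
    have h1 : HasDerivWithinAt (fun x => z 0 + ∫ t in (0 : ℝ)..x, v t) (v x) (Icc 0 L) x := by
      have : Fact (x ∈ Icc 0 L) := ⟨hx⟩
      refine (intervalIntegral.integral_hasDerivWithinAt_right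
        ((hvc.mono ?_).intervalIntegrable) ?_ (hvc x hx)).const_add _
      · rw [uIcc_of_le hx.1]; exact Icc_subset_Icc le_rfl hx.2
      · exact hvc.stronglyMeasurableAtFilter_nhdsWithin measurableSet_Icc x
    exact h1.congr (fun t ht => (hyz t ht).trans (hzint t ht)) ((hyz x hx).trans (hzint x hx))
  · rw [ae_restrict_iff' measurableSet_Ioo]
    filter_upwards [hAd, hBd] with x h1 h2 hx
    refine ⟨?_, by ring⟩
    refine (((hasDerivAt_cos_mul ρ x).mul ((h1 hx).const_add b)).sub
      (((hasDerivAt_sinDiv ρ x).mul ((h2 hx).const_sub a)).const_mul (ρ ^ 2))).congr_deriv ?_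
    have h3 := hyz x (Ioo_subset_Icc_self hx)
    have h4 := cos_sq_add_sinDiv_sq ρ x
    rw [hz] at h3
    simp only at h3
    linear_combination (q x * y x) * h4 + ρ ^ 2 * h3
  · rw [hyz 0 ⟨le_rfl, hL⟩]; simp [hz, hB]
  · simp [hv, hA]

/-! ### The Goursat integral equation -/

/-- The projection of `u` to the interval `[-t, t]` (for `t ≥ 0`). -/
def clip (t u : ℝ) : ℝ := max (-t) (min t u)

@[fun_prop]
theorem Continuous.clip {X : Type*} [TopologicalSpace X] {f g : X → ℝ} (hf : Continuous f)
    (hg : Continuous g) : Continuous fun x => clip (f x) (g x) := by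
  unfold SturmLiouville.clip
  fun_prop

theorem abs_clip_sub_clip_le (t u v : ℝ) : |clip t u - clip t v| ≤ |u - v| := by
  unfold clip
  refine (abs_max_sub_max_le_max _ _ _ _).trans (max_le (by simp) ?_)
  refine (abs_min_sub_min_le_max _ _ _ _).trans (max_le (by simp) le_rfl)

theorem clip_of_mem {t u : ℝ} (h : u ∈ Icc (-t) t) : clip t u = u := by
  unfold clip
  rw [min_eq_right h.2, max_eq_right h.1]

theorem clip_of_le {t u : ℝ} (ht : 0 ≤ t) (h : t ≤ u) : clip t u = t := by
  unfold clip
  rw [min_eq_left h, max_eq_right (by linarith)]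

theorem clip_of_le_neg {t u : ℝ} (ht : 0 ≤ t) (h : u ≤ -t) : clip t u = -t := by
  unfold clip
  rw [min_eq_right (by linarith), max_eq_left h]

theorem continuous_integral_interval {X : Type*} [TopologicalSpace X] {f : X → ℝ → ℂ}
    (hf : Continuous f.uncurry) {a b : X → ℝ} (ha : Continuous a) (hb : Continuous b) :
    Continuous fun x => ∫ s in a x..b x, f x s := by
  have h : ∀ x, ∫ s in a x..b x, f x s = (∫ s in (0 : ℝ)..b x, f x s) - ∫ s in (0 : ℝ)..a x, f x s := by
    intro x
    have hc : Continuous (f x) := hf.comp (Continuous.prodMk_right x)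
    rw [intervalIntegral.integral_interval_sub_left] <;> exact hc.intervalIntegrable _ _
  simp_rw [h]
  exact (intervalIntegral.continuous_parametric_intervalIntegral_of_continuous hf hb).sub
    (intervalIntegral.continuous_parametric_intervalIntegral_of_continuous hf ha)

/-- The inner integral of the Goursat equation, with an exponential weight. -/
noncomputable def goursatInner (lam : ℝ) (k : ℝ × ℝ → ℂ) (z : ℝ × ℝ) (t : ℝ) : ℂ :=
  (Real.exp (-lam * max 0 (z.1 - t)) : ℂ) *
    ∫ s in clip t (z.2 - max 0 (z.1 - t))..clip t (z.2 + max 0 (z.1 - t)), k (t, s)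

theorem continuous_goursatInner (lam : ℝ) {k : ℝ × ℝ → ℂ} (hk : Continuous k) :
    Continuous fun w : (ℝ × ℝ) × ℝ => goursatInner lam k w.1 w.2 := by
  unfold goursatInner
  refine Continuous.mul (by fun_prop) ?_
  exact continuous_integral_interval (f := fun (w : (ℝ × ℝ) × ℝ) s => k (w.2, s))
    (by simp only [Function.uncurry_def]; fun_prop) (by fun_prop) (by fun_prop)

/-- Clipping is 1-Lipschitz, so the window has length at most `2p`; the weight compensates for this
growth because `e^(-lam p) · lam p ≤ 1`. The bound is uniform in `z` and `t`, and a large `lam`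
makes it small. -/
theorem norm_goursatInner_le {lam : ℝ} (hlam : 0 < lam) {k : ℝ × ℝ → ℂ} {C : ℝ}
    (hk : ∀ z, ‖k z‖ ≤ C) (z : ℝ × ℝ) (t : ℝ) :
    ‖goursatInner lam k z t‖ ≤ 2 / lam * C := by
  have hC : 0 ≤ C := (norm_nonneg _).trans (hk 0)
  unfold goursatInner
  set p := max 0 (z.1 - t) with hp
  have hp0 : 0 ≤ p := le_max_left _ _
  have h1 : ‖∫ s in clip t (z.2 - p)..clip t (z.2 + p), k (t, s)‖ ≤ C * (2 * p) := by
    refine (intervalIntegral.norm_integral_le_of_norm_le_const fun s _ => hk (t, s)).trans ?_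
    refine mul_le_mul_of_nonneg_left ((abs_clip_sub_clip_le _ _ _).trans (le_of_eq ?_)) hC
    rw [show z.2 + p - (z.2 - p) = 2 * p by ring, abs_of_nonneg (by positivity)]
  have h2 : Real.exp (-lam * p) * (lam * p) ≤ 1 := by
    have : lam * p ≤ Real.exp (lam * p) := by linarith [Real.add_one_le_exp (lam * p)]
    calc Real.exp (-lam * p) * (lam * p) ≤ Real.exp (-lam * p) * Real.exp (lam * p) := by gcongr
      _ = 1 := by rw [← Real.exp_add]; simp
  rw [norm_mul, Complex.norm_real, Real.norm_of_nonneg (Real.exp_pos _).le]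
  calc _ ≤ Real.exp (-lam * p) * (C * (2 * p)) := by gcongr
    _ = 2 / lam * C * (Real.exp (-lam * p) * (lam * p)) := by field_simp
    _ ≤ 2 / lam * C * 1 := by gcongr
    _ = _ := mul_one _

theorem goursatInner_sub (lam : ℝ) {k l : ℝ × ℝ → ℂ} (hk : Continuous k) (hl : Continuous l)
    (z : ℝ × ℝ) (t : ℝ) :
    goursatInner lam (fun z => k z - l z) z t = goursatInner lam k z t - goursatInner lam l z t := by
  unfold goursatInner
  rw [intervalIntegral.integral_sub (Continuous.intervalIntegrable (by fun_prop) _ _)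
    (Continuous.intervalIntegrable (by fun_prop) _ _), mul_sub]

theorem integrable_mul_goursatInner {q : ℝ → ℂ} (hq : Integrable q) {lam : ℝ} (hlam : 0 < lam)
    {k : ℝ × ℝ → ℂ} (hk : Continuous k) {C : ℝ} (hC : ∀ z, ‖k z‖ ≤ C) (z : ℝ × ℝ) :
    Integrable fun t => q t * goursatInner lam k z t := by
  refine hq.mul_bdd (c := 2 / lam * C) ?_ ?_
  · exact ((continuous_goursatInner lam hk).comp (Continuous.prodMk_right z)).aestronglyMeasurable
  · exact Eventually.of_forall fun t => norm_goursatInner_le hlam hC z t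

theorem norm_mul_goursatInner_le {q : ℝ → ℂ} {lam : ℝ} (hlam : 0 < lam)
    {k : ℝ × ℝ → ℂ} {C : ℝ} (hC : ∀ z, ‖k z‖ ≤ C) (z : ℝ × ℝ) (t : ℝ) :
    ‖q t * goursatInner lam k z t‖ ≤ ‖q t‖ * (2 / lam * C) := by
  rw [norm_mul]
  exact mul_le_mul_of_nonneg_left (norm_goursatInner_le hlam hC z t) (norm_nonneg _)

theorem norm_integral_mul_goursatInner_le {q : ℝ → ℂ} (hq : Integrable q) {lam : ℝ}
    (hlam : 0 < lam) {k : ℝ × ℝ → ℂ} {C : ℝ} (hC : ∀ z, ‖k z‖ ≤ C) (z : ℝ × ℝ) :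
    ‖∫ t, q t * goursatInner lam k z t‖ ≤ (∫ t, ‖q t‖) * (2 / lam * C) := by
  rw [← integral_mul_const]
  exact norm_integral_le_of_norm_le (hq.norm.mul_const _)
    (Eventually.of_forall fun t => norm_mul_goursatInner_le hlam hC z t)

theorem continuous_integral_mul_goursatInner {q : ℝ → ℂ} (hq : Integrable q) {lam : ℝ}
    (hlam : 0 < lam) {k : ℝ × ℝ → ℂ} (hk : Continuous k) {C : ℝ} (hC : ∀ z, ‖k z‖ ≤ C) :
    Continuous fun z => ∫ t, q t * goursatInner lam k z t := by
  refine continuous_of_dominated (bound := fun t => ‖q t‖ * (2 / lam * C))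
    (fun z => (integrable_mul_goursatInner hq hlam hk hC z).aestronglyMeasurable)
    (fun z => Eventually.of_forall fun t => norm_mul_goursatInner_le hlam hC z t)
    (hq.norm.mul_const _) (Eventually.of_forall fun t => ?_)
  exact continuous_const.mul ((continuous_goursatInner lam hk).comp (Continuous.prodMk_left t))

/-- The free term of the Goursat equation, with an exponential weight. -/
noncomputable def goursatFree (q : ℝ → ℂ) (lam : ℝ) (z : ℝ × ℝ) : ℂ :=
  (Real.exp (-lam * max 0 z.1) : ℂ) * (1 / 2 * ∫ t in (0 : ℝ)..(z.1 + z.2) / 2, q t)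

theorem continuous_goursatFree {q : ℝ → ℂ} (hq : Integrable q) (lam : ℝ) :
    Continuous (goursatFree q lam) := by
  have h : Continuous fun u => ∫ t in (0 : ℝ)..u, q t := hq.continuous_primitive 0
  have h2 : Continuous fun z : ℝ × ℝ => ∫ t in (0 : ℝ)..(z.1 + z.2) / 2, q t :=
    h.comp (g := fun u => ∫ t in (0 : ℝ)..u, q t) (f := fun z : ℝ × ℝ => (z.1 + z.2) / 2)
      (by fun_prop)
  unfold goursatFree
  fun_prop

theorem norm_goursatFree_le {q : ℝ → ℂ} (hq : Integrable q) {lam : ℝ} (hlam : 0 < lam)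
    (z : ℝ × ℝ) : ‖goursatFree q lam z‖ ≤ ∫ t, ‖q t‖ := by
  unfold goursatFree
  have h1 : ‖∫ t in (0 : ℝ)..(z.1 + z.2) / 2, q t‖ ≤ ∫ t, ‖q t‖ :=
    intervalIntegral.norm_integral_le_integral_norm_uIoc.trans
      (setIntegral_le_integral hq.norm (Eventually.of_forall fun t => norm_nonneg _))
  have h2 : Real.exp (-lam * max 0 z.1) ≤ 1 := by
    rw [Real.exp_le_one_iff]
    nlinarith [le_max_left 0 z.1]
  have h3 : 0 ≤ ∫ t, ‖q t‖ := integral_nonneg fun t => norm_nonneg _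
  rw [norm_mul, norm_mul, Complex.norm_real, Real.norm_of_nonneg (Real.exp_pos _).le]
  rw [show ‖(1 / 2 : ℂ)‖ = 1 / 2 by norm_num]
  calc _ ≤ 1 * (1 / 2 * ∫ t, ‖q t‖) := by gcongr
    _ ≤ _ := by linarith

open BoundedContinuousFunction in
theorem exists_goursat_fixedPoint {q : ℝ → ℂ} (hq : Integrable q) :
    ∃ lam : ℝ, ∃ k : ℝ × ℝ → ℂ, Continuous k ∧ ∀ z, k z = goursatFree q lam z +
      1 / 2 * ∫ t, q t * goursatInner lam k z t := by
  have hQ : 0 ≤ ∫ t, ‖q t‖ := integral_nonneg fun t => norm_nonneg _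
  -- This value gives `‖q‖₁ · 2/lam ≤ 1`, so the prefactor `1/2` is the contraction constant; the `+
  -- 1` keeps `lam` positive when `q` vanishes.
  set lam : ℝ := 2 * (∫ t, ‖q t‖) + 1 with hl
  have hlam : 0 < lam := by positivity
  let F : (ℝ × ℝ →ᵇ ℂ) → (ℝ × ℝ →ᵇ ℂ) := fun k =>
    BoundedContinuousFunction.ofNormedAddCommGroup
      (fun z => goursatFree q lam z + 1 / 2 * ∫ t, q t * goursatInner lam k z t)
      ((continuous_goursatFree hq lam).add (continuous_const.mul
        (continuous_integral_mul_goursatInner hq hlam k.continuous k.norm_coe_le_norm)))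
      ((∫ t, ‖q t‖) + ‖(1 / 2 : ℂ)‖ * ((∫ t, ‖q t‖) * (2 / lam * ‖k‖)))
      (fun z => (norm_add_le _ _).trans (add_le_add (norm_goursatFree_le hq hlam z)
        ((norm_mul_le _ _).trans (mul_le_mul_of_nonneg_left
          (norm_integral_mul_goursatInner_le hq hlam k.norm_coe_le_norm z) (norm_nonneg _)))))
  have hF : ∀ k z, F k z = goursatFree q lam z + 1 / 2 * ∫ t, q t * goursatInner lam k z t :=
    fun k z => rfl
  have hcontr : ContractingWith (1 / 2) F := by
    refine ⟨by norm_num, LipschitzWith.of_dist_le_mul fun k l => ?_⟩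
    refine (BoundedContinuousFunction.dist_le (by positivity)).2 fun z => ?_
    have hkl : ∀ z, ‖k z - l z‖ ≤ dist k l := fun z => by
      rw [← dist_eq_norm]; exact BoundedContinuousFunction.dist_coe_le_dist z
    have h1 : F k z - F l z =
        1 / 2 * ∫ t, q t * goursatInner lam (fun z => k z - l z) z t := by
      rw [hF, hF, add_sub_add_left_eq_sub, ← mul_sub, ← integral_sub
        (integrable_mul_goursatInner hq hlam k.continuous k.norm_coe_le_norm z)
        (integrable_mul_goursatInner hq hlam l.continuous l.norm_coe_le_norm z)]
      simp_rw [goursatInner_sub lam k.continuous l.continuous, mul_sub]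
    rw [dist_eq_norm, h1, norm_mul]
    have h2 := norm_integral_mul_goursatInner_le hq hlam hkl z
    have h3 : (∫ t, ‖q t‖) * (2 / lam) ≤ 1 := by
      rw [mul_div_assoc', div_le_one hlam]
      linarith
    have h4 : (∫ t, ‖q t‖) * (2 / lam * dist k l) ≤ dist k l := by
      calc _ = (∫ t, ‖q t‖) * (2 / lam) * dist k l := by ring
        _ ≤ 1 * dist k l := by gcongr
        _ = _ := one_mul _
    have h5 : ‖(1 / 2 : ℂ)‖ = 1 / 2 := by norm_num
    rw [h5]
    push_cast
    linarith
  refine ⟨lam, hcontr.fixedPoint, (hcontr.fixedPoint).continuous, fun z => ?_⟩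
  conv_lhs => rw [← hcontr.fixedPoint_isFixedPt]
  exact hF _ z

/-- The Goursat equation has a continuous solution. -/
theorem exists_goursat_kernel {q : ℝ → ℂ} (hq : Integrable q) (hq0 : ∀ t ≤ 0, q t = 0) :
    ∃ K : ℝ → ℝ → ℂ, Continuous K.uncurry ∧ ∀ x, 0 ≤ x → ∀ r,
      K x r = 1 / 2 * (∫ t in (0 : ℝ)..(x + r) / 2, q t) +
        1 / 2 * ∫ t in (0 : ℝ)..x, q t *
          ∫ s in clip t (r - (x - t))..clip t (r + (x - t)), K t s := by
  obtain ⟨lam, k, hk, h⟩ := exists_goursat_fixedPoint hq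
  -- The weight is removed by `e^(lam x) e^(-lam (x-t)) = e^(lam t)`, which is the factor that turns
  -- `k (t, s)` into `K t s`.
  refine ⟨fun x r => Complex.exp (lam * x) * k (x, r), ?_, fun x hx r => ?_⟩
  · simp only [Function.uncurry_def]
    fun_prop
  -- For `t ≤ 0` the potential vanishes; for `t > x` the truncated radius `max 0 (x - t)` is zero
  -- and the window is empty.
  have h1 : ∫ t, q t * goursatInner lam k (x, r) t =
      ∫ t in (0 : ℝ)..x, q t * goursatInner lam k (x, r) t := by
    rw [intervalIntegral.integral_of_le hx, setIntegral_eq_integral_of_forall_compl_eq_zero]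
    intro t ht
    rcases le_or_gt t 0 with h0 | h0
    · simp [hq0 t h0]
    · have hxt : x < t := by
        by_contra hcon
        exact ht ⟨h0, not_lt.1 hcon⟩
      have : max 0 (x - t) = 0 := max_eq_left (by linarith)
      simp [goursatInner, this]
  beta_reduce
  rw [h, h1, goursatFree, max_eq_right hx, mul_add]
  congr 1
  · push_cast
    rw [← mul_assoc, ← Complex.exp_add]
    simp
  · rw [mul_left_comm, ← intervalIntegral.integral_const_mul]
    congr 1
    refine intervalIntegral.integral_congr fun t ht => ?_
    rw [uIcc_of_le hx] at ht
    simp only [goursatInner]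
    rw [max_eq_right (sub_nonneg.2 ht.2), intervalIntegral.integral_const_mul]
    push_cast
    rw [mul_left_comm, ← mul_assoc (Complex.exp _) (Complex.exp _), ← Complex.exp_add]
    congr 3
    ring

/-! ### From the Goursat equation to the Volterra equation -/

theorem hasDerivAt_integral_of_continuous {m : ℝ → ℂ} (hm : Continuous m) (a x : ℝ) :
    HasDerivAt (fun x => ∫ r in a..x, m r) (m x) x :=
  intervalIntegral.integral_hasDerivAt_right (hm.intervalIntegrable _ _)
    hm.stronglyMeasurable.stronglyMeasurableAtFilter hm.continuousAt

/-- Both sides vanish at `a = 0`, and by `hadd` they have the same derivative `cos(ρa) m(b)` in `a`.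
This removes `ρ` from the Volterra kernel. -/
theorem sinDiv_mul_mode {ρ : ℂ} {m : ℝ → ℂ} (hm : Continuous m)
    (hadd : ∀ a b : ℝ, m (b + a) + m (b - a) = 2 * Complex.cos (ρ * a) * m b) (a b : ℝ) :
    sinDiv ρ a * m b = 1 / 2 * ∫ r in (b - a)..(b + a), m r := by
  set M : ℝ → ℂ := fun x => ∫ r in (0 : ℝ)..x, m r with hM
  have hMd : ∀ x, HasDerivAt M (m x) x := fun x => hasDerivAt_integral_of_continuous hm 0 x
  have hd : ∀ a, HasDerivAt (fun a => sinDiv ρ a * m b - 1 / 2 * (M (b + a) - M (b - a))) 0 a := by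
    intro a
    have h1 : HasDerivAt (fun a => M (b + a)) (m (b + a)) a := by
      simpa [Function.comp_def] using (hMd (b + a)).scomp a ((hasDerivAt_id a).const_add b)
    have h2 : HasDerivAt (fun a => M (b - a)) (-m (b - a)) a := by
      simpa [Function.comp_def] using (hMd (b - a)).scomp a ((hasDerivAt_id a).const_sub b)
    refine (((hasDerivAt_sinDiv ρ a).mul_const (m b)).sub
      ((h1.sub h2).const_mul (1 / 2 : ℂ))).congr_deriv ?_
    linear_combination (-1 / 2) * hadd a b
  have := is_const_of_deriv_eq_zero (fun a => (hd a).differentiableAt) (fun a => (hd a).deriv) a 0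
  simp only [sinDiv_zero_right, add_zero, sub_zero, sub_self, zero_mul, mul_zero] at this
  rw [← intervalIntegral.integral_interval_sub_left (hm.intervalIntegrable 0 _)
    (hm.intervalIntegrable 0 _)]
  linear_combination this

/-- Exchange of order over the triangle `0 ≤ t`, `2t - x ≤ r ≤ x`, carried out by parts and the
substitution `r = 2t - x`. The boundary terms vanish: the primitive of `q` at `0`, the inner
integral at `t = x`. -/
theorem integral_mul_integral_cone {q m : ℝ → ℂ} (hq : Integrable q) (hm : Continuous m) {x : ℝ}
    (hx : 0 ≤ x) :
    ∫ t in (0 : ℝ)..x, q t * ∫ r in (2 * t - x)..x, m r =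
      ∫ r in (-x)..x, (∫ t in (0 : ℝ)..(x + r) / 2, q t) * m r := by
  set Q : ℝ → ℂ := fun u => ∫ t in (0 : ℝ)..u, q t with hQ
  have hQc : Continuous Q := hq.continuous_primitive 0
  have hMd : ∀ t, HasDerivAt (fun t => ∫ r in (2 * t - x)..x, m r) (-(2 * m (2 * t - x))) t := by
    intro t
    have h := (hasDerivAt_integral_of_continuous hm x (2 * t - x)).scomp t
      (((hasDerivAt_id t).const_mul (2 : ℝ)).sub_const x)
    simp only [Function.comp_def, id_eq, mul_one] at h
    have h' := h.neg
    refine (h'.congr_deriv (by simp)).congr_of_eventuallyEq (Eventually.of_forall fun t => ?_)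
    exact (intervalIntegral.integral_symm _ _)
  have hMc : Continuous fun t => ∫ r in (2 * t - x)..x, m r :=
    continuous_iff_continuousAt.2 fun t => (hMd t).continuousAt
  have hi1 : IntervalIntegrable (fun t => q t * ∫ r in (2 * t - x)..x, m r) volume 0 x :=
    hq.intervalIntegrable.mul_continuousOn hMc.continuousOn
  have hi2 : IntervalIntegrable (fun t => Q t * (2 * m (2 * t - x))) volume 0 x :=
    Continuous.intervalIntegrable (by fun_prop) _ _
  have h := integral_eq_sub_of_absolutelyContinuous hx
    (f := fun t => Q t * ∫ r in (2 * t - x)..x, m r)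
    (absolutelyContinuousOnInterval_mul
      (absolutelyContinuousOnInterval_primitive hq.intervalIntegrable left_mem_uIcc)
      (absolutelyContinuousOnInterval_of_hasDerivAt hMd (by fun_prop) 0 x)) (hi1.sub hi2) (by
        filter_upwards [(hq.intervalIntegrable (a := 0) (b := x)).ae_hasDerivAt_integral]
          with t ht htx
        have := ht (by rw [uIcc_of_le hx]; exact Ioo_subset_Icc_self htx) 0 left_mem_uIcc
        refine (this.mul (hMd t)).congr_deriv ?_
        simp only [hQ]
        ring)
  rw [intervalIntegral.integral_sub hi1 hi2] at h
  have h0 : Q 0 = 0 := by simp [hQ]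
  have hs : ∫ t in (0 : ℝ)..x, Q t * (2 * m (2 * t - x)) = ∫ r in (-x)..x, Q ((x + r) / 2) * m r := by
    have := intervalIntegral.smul_integral_comp_mul_sub (a := 0) (b := x)
      (fun r => Q ((x + r) / 2) * m r) 2 x
    rw [mul_zero, zero_sub, show 2 * x - x = x by ring] at this
    rw [← this, ← intervalIntegral.integral_smul]
    refine intervalIntegral.integral_congr fun t _ => ?_
    simp only [Complex.real_smul]
    rw [show (x + (2 * t - x)) / 2 = t by ring]
    push_cast
    ring
  rw [h0, show 2 * x - x = x by ring, intervalIntegral.integral_same, mul_zero, zero_mul, sub_zero,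
    hs] at h
  exact sub_eq_zero.1 h

/-- Exchange of order over `|r| ≤ t`, `|u - r| ≤ p`: for fixed `u` the section `[-t,t] ∩ [u-p,u+p]`
has the clipped endpoints. In terms of primitives, each edge `u = r + c` with `c = ±p` contributes
one integration by parts, and beyond `±t + c` the clipped argument is constant. -/
theorem integral_mul_integral_window {k m : ℝ → ℂ} (hk : Continuous k) (hm : Continuous m)
    {t p : ℝ} (ht : 0 ≤ t) (hp : 0 ≤ p) :
    ∫ r in (-t)..t, k r * ∫ u in (r - p)..(r + p), m u =
      ∫ u in (-(t + p))..(t + p), m u * ∫ r in clip t (u - p)..clip t (u + p), k r := by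
  set k' : ℝ → ℂ := fun x => ∫ r in (0 : ℝ)..x, k r with hk'
  set M : ℝ → ℂ := fun x => ∫ r in (0 : ℝ)..x, m r with hM
  have hkd : ∀ x, HasDerivAt k' (k x) x := fun x => hasDerivAt_integral_of_continuous hk 0 x
  have hMd : ∀ x, HasDerivAt M (m x) x := fun x => hasDerivAt_integral_of_continuous hm 0 x
  have hkc : Continuous k' := continuous_iff_continuousAt.2 fun t => (hkd t).continuousAt
  have hMc : Continuous M := continuous_iff_continuousAt.2 fun t => (hMd t).continuousAt
  have hint : ∀ a b, ∫ u in a..b, m u = M b - M a := fun a b =>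
    (intervalIntegral.integral_interval_sub_left (hm.intervalIntegrable 0 _)
      (hm.intervalIntegrable 0 _)).symm
  have hintk : ∀ a b, ∫ u in a..b, k u = k' b - k' a := fun a b =>
    (intervalIntegral.integral_interval_sub_left (hk.intervalIntegrable 0 _)
      (hk.intervalIntegrable 0 _)).symm
  have hMs : ∀ c x, HasDerivAt (fun x => M (x + c)) (m (x + c)) x := fun c x => by
    simpa [Function.comp_def] using (hMd (x + c)).scomp x ((hasDerivAt_id x).add_const c)
  have parts : ∀ c, ∫ r in (-t)..t, (k r * M (r + c) + k' r * m (r + c)) =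
      k' t * M (t + c) - k' (-t) * M (-t + c) := fun c =>
    intervalIntegral.integral_eq_sub_of_hasDerivAt
      (fun x _ => (hkd x).mul (hMs c x)) (Continuous.intervalIntegrable (by fun_prop) _ _)
  -- the clipped primitive integrated against a translate of `m`
  have clipped : ∀ c, |c| ≤ p → ∫ u in (-(t + p))..(t + p), m u * k' (clip t (u - c)) =
      (∫ r in (-t)..t, k' r * m (r + c)) + k' t * (M (t + p) - M (t + c)) +
        k' (-t) * (M (-t + c) - M (-(t + p))) := by
    intro c hc
    obtain ⟨hc1, hc2⟩ := abs_le.1 hc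
    have hI : ∀ a b, IntervalIntegrable (fun u => m u * k' (clip t (u - c))) volume a b :=
      fun a b => Continuous.intervalIntegrable (by fun_prop) _ _
    rw [← intervalIntegral.integral_add_adjacent_intervals (hI _ (-t + c)) (hI _ _),
      ← intervalIntegral.integral_add_adjacent_intervals (hI (-t + c) (t + c)) (hI _ _)]
    have e1 : ∫ u in (-(t + p))..(-t + c), m u * k' (clip t (u - c)) =
        k' (-t) * (M (-t + c) - M (-(t + p))) := by
      rw [← hint, ← intervalIntegral.integral_const_mul]
      refine intervalIntegral.integral_congr fun u hu => ?_
      rw [uIcc_of_le (by linarith)] at hu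
      simp only [clip_of_le_neg ht (show u - c ≤ -t by linarith [hu.2])]
      ring
    have e3 : ∫ u in (t + c)..(t + p), m u * k' (clip t (u - c)) =
        k' t * (M (t + p) - M (t + c)) := by
      rw [← hint, ← intervalIntegral.integral_const_mul]
      refine intervalIntegral.integral_congr fun u hu => ?_
      rw [uIcc_of_le (by linarith)] at hu
      simp only [clip_of_le ht (show t ≤ u - c by linarith [hu.1])]
      ring
    have e2 : ∫ u in (-t + c)..(t + c), m u * k' (clip t (u - c)) =
        ∫ r in (-t)..t, k' r * m (r + c) := by
      rw [← intervalIntegral.integral_comp_add_right (fun u => m u * k' (clip t (u - c)))]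
      refine intervalIntegral.integral_congr fun u hu => ?_
      rw [uIcc_of_le (by linarith)] at hu
      simp only [add_sub_cancel_right, clip_of_mem hu]
      ring
    rw [e1, e2, e3]
    ring
  have c1 := clipped p (by rw [abs_of_nonneg hp])
  have c2 := clipped (-p) (by rw [abs_neg, abs_of_nonneg hp])
  have p1 := parts p
  have p2 := parts (-p)
  rw [intervalIntegral.integral_add (Continuous.intervalIntegrable (by fun_prop) _ _)
    (Continuous.intervalIntegrable (by fun_prop) _ _)] at p1 p2
  simp_rw [hint, hintk, mul_sub]
  rw [intervalIntegral.integral_sub (Continuous.intervalIntegrable (by fun_prop) _ _)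
    (Continuous.intervalIntegrable (by fun_prop) _ _),
    intervalIntegral.integral_sub (Continuous.intervalIntegrable (by fun_prop) _ _)
    (Continuous.intervalIntegrable (by fun_prop) _ _)]
  simp only [sub_neg_eq_add, ← sub_eq_add_neg] at c1 c2 p1 p2
  rw [c1, c2]
  rw [show -(t + p) = -t - p by ring]
  linear_combination p1 - p2

theorem integral_volterra_swap {q m : ℝ → ℂ} (hq : Integrable q) (hm : Continuous m)
    {J : ℝ → ℝ → ℂ} (hJ : Continuous J.uncurry) {x : ℝ} (hx : 0 ≤ x) :
    ∫ t in (0 : ℝ)..x, q t * ∫ u in (-x)..x, m u * J t u =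
      ∫ u in (-x)..x, m u * ∫ t in (0 : ℝ)..x, q t * J t u := by
  have hxx : -x ≤ x := by linarith
  simp_rw [← intervalIntegral.integral_const_mul]
  simp_rw [intervalIntegral.integral_of_le hx, intervalIntegral.integral_of_le hxx]
  rw [integral_integral_swap]
  · simp_rw [mul_left_comm]
  · have hm' : Integrable m (volume.restrict (Ioc (-x) x)) :=
      (hm.intervalIntegrable (-x) x).1
    obtain ⟨C, hC⟩ := (isCompact_Icc (a := ((0 : ℝ), -x)) (b := (x, x))).exists_bound_of_continuousOn
      hJ.continuousOn
    have h1 := (hq.restrict (s := Ioc 0 x)).mul_prod hm'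
    have h2 := h1.mul_bdd (c := C) (g := J.uncurry) hJ.aestronglyMeasurable (by
      rw [Measure.prod_restrict, ae_restrict_iff' (measurableSet_Ioc.prod measurableSet_Ioc)]
      refine Eventually.of_forall fun z hz => hC z ?_
      exact ⟨⟨hz.1.1.le, hz.2.1.le⟩, ⟨hz.1.2, hz.2.2⟩⟩)
    refine h2.congr (Eventually.of_forall fun z => ?_)
    simp only [Function.uncurry_def]
    ring

/-- If `K` solves the Goursat equation, then `m + ∫ K m` solves the Volterra equation with free
term `m`, for every `m` satisfying d'Alembert's functional equation. -/
theorem volterra_of_goursat {q : ℝ → ℂ} (hq : Integrable q) {K : ℝ → ℝ → ℂ}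
    (hK : Continuous K.uncurry) (hKeq : ∀ x, 0 ≤ x → ∀ r,
      K x r = 1 / 2 * (∫ t in (0 : ℝ)..(x + r) / 2, q t) +
        1 / 2 * ∫ t in (0 : ℝ)..x, q t *
          ∫ s in clip t (r - (x - t))..clip t (r + (x - t)), K t s)
    {ρ : ℂ} {m : ℝ → ℂ} (hm : Continuous m)
    (hadd : ∀ a b : ℝ, m (b + a) + m (b - a) = 2 * Complex.cos (ρ * a) * m b)
    {x : ℝ} (hx : 0 ≤ x) :
    ∫ r in (-x)..x, K x r * m r = ∫ t in (0 : ℝ)..x, sinDiv ρ (x - t) *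
      (q t * (m t + ∫ r in (-t)..t, K t r * m r)) := by
  set J : ℝ → ℝ → ℂ := fun t u => ∫ s in clip t (u - (x - t))..clip t (u + (x - t)), K t s with hJ
  have hJc : Continuous J.uncurry :=
    continuous_integral_interval (f := fun (w : ℝ × ℝ) s => K w.1 s)
      (hK.comp (f := fun w : (ℝ × ℝ) × ℝ => (w.1.1, w.2)) (by fun_prop)) (by fun_prop)
      (by fun_prop)
  have hKt : ∀ t, Continuous (K t) := fun t => hK.comp (Continuous.prodMk_right t)
  have hQc : Continuous fun u => ∫ t in (0 : ℝ)..u, q t := hq.continuous_primitive 0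
  have hQc' : Continuous fun r => ∫ t in (0 : ℝ)..(x + r) / 2, q t :=
    hQc.comp (f := fun r : ℝ => (x + r) / 2) (by fun_prop)
  have hcc : Continuous fun t => ∫ r in (2 * t - x)..x, m r :=
    continuous_integral_interval (f := fun _ r => m r) (by fun_prop) (by fun_prop) (by fun_prop)
  have hJJ : Continuous fun t => ∫ u in (-x)..x, m u * J t u := by
    refine intervalIntegral.continuous_parametric_intervalIntegral_of_continuous' ?_ _ _
    exact (hm.comp continuous_snd).mul hJc
  have e1 : ∫ t in (0 : ℝ)..x, sinDiv ρ (x - t) *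
      (q t * (m t + ∫ r in (-t)..t, K t r * m r)) =
      ∫ t in (0 : ℝ)..x, (1 / 2 * (q t * ∫ r in (2 * t - x)..x, m r) +
        1 / 2 * (q t * ∫ u in (-x)..x, m u * J t u)) := by
    refine intervalIntegral.integral_congr fun t ht => ?_
    rw [uIcc_of_le hx] at ht
    have h1 : sinDiv ρ (x - t) * m t = 1 / 2 * ∫ r in (2 * t - x)..x, m r := by
      rw [sinDiv_mul_mode hm hadd]
      congr 2 <;> ring
    have h2 : sinDiv ρ (x - t) * ∫ r in (-t)..t, K t r * m r =
        1 / 2 * ∫ u in (-x)..x, m u * J t u := by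
      have := integral_mul_integral_window (hKt t) hm ht.1 (sub_nonneg.2 ht.2)
      -- The window radius is `x - t`, so the outer range `±(t + (x - t))` becomes `[-x, x]`,
      -- independent of `t` and ready for Fubini.
      rw [add_sub_cancel] at this
      rw [hJ, ← this, ← intervalIntegral.integral_const_mul,
        ← intervalIntegral.integral_const_mul]
      refine intervalIntegral.integral_congr fun r _ => ?_
      rw [mul_left_comm, sinDiv_mul_mode hm hadd]
      ring
    linear_combination (q t) * h1 + (q t) * h2
  have hi1 : IntervalIntegrable (fun t => q t * ∫ r in (2 * t - x)..x, m r) volume 0 x :=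
    hq.intervalIntegrable.mul_continuousOn hcc.continuousOn
  have hi2 : IntervalIntegrable (fun t => q t * ∫ u in (-x)..x, m u * J t u) volume 0 x :=
    hq.intervalIntegrable.mul_continuousOn hJJ.continuousOn
  have hrem : ∀ r, (1 / 2 : ℂ) * ∫ t in (0 : ℝ)..x, q t * J t r =
      K x r - 1 / 2 * ∫ t in (0 : ℝ)..(x + r) / 2, q t := fun r => by
    rw [hKeq x hx r]
    ring
  have e2 : ∫ r in (-x)..x, K x r * m r =
      ∫ r in (-x)..x, (1 / 2 * ((∫ t in (0 : ℝ)..(x + r) / 2, q t) * m r) +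
        1 / 2 * (m r * ∫ t in (0 : ℝ)..x, q t * J t r)) := by
    refine intervalIntegral.integral_congr fun r _ => ?_
    linear_combination (-m r) * hrem r
  -- Continuity is read off from the Goursat equation, whose other terms are continuous.
  have hqJ : Continuous fun r => ∫ t in (0 : ℝ)..x, q t * J t r := by
    have : (fun r => ∫ t in (0 : ℝ)..x, q t * J t r) =
        fun r => 2 * (K x r - 1 / 2 * ∫ t in (0 : ℝ)..(x + r) / 2, q t) := by
      funext r
      rw [← hrem]
      ring
    rw [this]
    exact continuous_const.mul ((hKt x).sub (continuous_const.mul hQc'))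
  have hi3 : IntervalIntegrable (fun r => (∫ t in (0 : ℝ)..(x + r) / 2, q t) * m r)
      volume (-x) x := (hQc'.mul hm).intervalIntegrable _ _
  have hi4 : IntervalIntegrable (fun r => m r * ∫ t in (0 : ℝ)..x, q t * J t r)
      volume (-x) x := (hm.mul hqJ).intervalIntegrable _ _
  rw [e1, e2, intervalIntegral.integral_add (hi1.const_mul _) (hi2.const_mul _),
    intervalIntegral.integral_add (hi3.const_mul _) (hi4.const_mul _)]
  simp only [intervalIntegral.integral_const_mul]
  rw [integral_mul_integral_cone hq hm hx, integral_volterra_swap hq hm hJc hx]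

theorem continuous_transmuted {K : ℝ → ℝ → ℂ} (hK : Continuous K.uncurry) {m : ℝ → ℂ}
    (hm : Continuous m) : Continuous fun x => ∫ r in (-x)..x, K x r * m r := by
  refine continuous_integral_interval (f := fun x r => K x r * m r) ?_ (by fun_prop) (by fun_prop)
  exact hK.mul (hm.comp continuous_snd)

theorem isCauchySolution_transmuted {L : ℝ} (hL : 0 ≤ L) {q : ℝ → ℂ} (hq : Integrable q)
    {K : ℝ → ℝ → ℂ}
    (hK : Continuous K.uncurry) (hKeq : ∀ x, 0 ≤ x → ∀ r,
      K x r = 1 / 2 * (∫ t in (0 : ℝ)..(x + r) / 2, q t) +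
        1 / 2 * ∫ t in (0 : ℝ)..x, q t *
          ∫ s in clip t (r - (x - t))..clip t (r + (x - t)), K t s) (ρ a b : ℂ) :
    IsCauchySolution L q ρ a b fun x => a * Complex.cos (ρ * x) + b * sinDiv ρ x +
      ∫ r in (-x)..x, K x r * (a * Complex.cos (ρ * r) + b * sinDiv ρ r) := by
  have hm : Continuous fun x : ℝ => a * Complex.cos (ρ * x) + b * sinDiv ρ x :=
    (continuous_const.mul (continuous_cos_mul ρ)).add (continuous_const.mul (continuous_sinDiv ρ))
  refine isCauchySolution_of_eq_integral hL hq.intervalIntegrable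
    (hm.add (continuous_transmuted hK hm)).continuousOn fun x hx => ?_
  rw [volterra_of_goursat hq hK hKeq hm (ρ := ρ) _ hx.1]
  intro s t
  simp only [cos_mul_add, cos_mul_sub, sinDiv_add, sinDiv_sub]
  ring

/-! ### Existence of the transmutation kernels -/

theorem IsCauchySolution.congr_potential {L : ℝ} {q q' : ℝ → ℂ} {ρ a b : ℂ} {y : ℝ → ℂ}
    (h : IsCauchySolution L q ρ a b y) (hqq : ∀ x ∈ Ioo 0 L, q x = q' x) :
    IsCauchySolution L q' ρ a b y := by
  obtain ⟨y', y'', h1, h2, h3, h4⟩ := h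
  refine ⟨y', y'', h1, h2, ?_, h4⟩
  rw [ae_restrict_iff' measurableSet_Ioo] at h3 ⊢
  filter_upwards [h3] with x hx hxL
  rw [← hqq x hxL]
  exact hx hxL

/-- There is a kernel that transmutes every combination of `cos (ρ x)` and `sin (ρ x) / ρ` into
the Cauchy solution with the same initial data. -/
theorem exists_transmutation_kernel {L : ℝ} (hL : 0 ≤ L) {q : ℝ → ℂ}
    (hq : IntervalIntegrable q volume 0 L) :
    ∃ K : ℝ → ℝ → ℂ, Continuous K.uncurry ∧ ∀ ρ a b : ℂ,
      IsCauchySolution L q ρ a b fun x => a * Complex.cos (ρ * x) + b * sinDiv ρ x +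
        ∫ r in (-x)..x, K x r * (a * Complex.cos (ρ * r) + b * sinDiv ρ r) := by
  have hq' : Integrable ((Ioc 0 L).indicator q) := by
    rw [integrable_indicator_iff measurableSet_Ioc]
    exact (intervalIntegrable_iff_integrableOn_Ioc_of_le hL).1 hq
  obtain ⟨K, hK, hKeq⟩ := exists_goursat_kernel hq' fun t ht =>
    indicator_of_notMem (fun h => absurd h.1 (not_lt.2 ht)) q
  refine ⟨K, hK, fun ρ a b => ?_⟩
  refine (isCauchySolution_transmuted hL hq' hK hKeq ρ a b).congr_potential fun x hx => ?_
  exact indicator_of_mem (Ioo_subset_Ioc_self hx) q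

theorem integral_symmetric_eq {f : ℝ → ℂ} (hf : Continuous f) (x : ℝ) :
    ∫ r in (-x)..x, f r = ∫ r in (0 : ℝ)..x, (f r + f (-r)) := by
  have hn : IntervalIntegrable (fun r => f (-r)) volume 0 x :=
    (hf.comp continuous_neg).intervalIntegrable _ _
  rw [intervalIntegral.integral_add (hf.intervalIntegrable _ _) hn, intervalIntegral.integral_comp_neg, neg_zero,
    add_comm, intervalIntegral.integral_add_adjacent_intervals (hf.intervalIntegrable _ _)
      (hf.intervalIntegrable _ _)]

/-- As `sinDiv ρ` is odd, folding the integral at `0` leaves the odd part of `K`. -/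
theorem exists_isKernelS {L : ℝ} (hL : 0 ≤ L) {q : ℝ → ℂ}
    (hq : IntervalIntegrable q volume 0 L) : ∃ K, IsKernelS L q K := by
  obtain ⟨K, hK, hsol⟩ := exists_transmutation_kernel hL hq
  have hKx : ∀ x, Continuous (K x) := fun x => hK.comp (Continuous.prodMk_right x)
  refine ⟨fun x t => K x t - K x (-t), fun x _ =>
    ((hKx x).sub ((hKx x).comp continuous_neg)).continuousOn, fun ρ => ⟨_, hsol ρ 0 1, ?_⟩⟩
  intro x _
  simp only [zero_mul, zero_add, one_mul]
  rw [integral_symmetric_eq (f := fun r => K x r * sinDiv ρ r)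
    ((hKx x).mul (continuous_sinDiv ρ))]
  congr 1
  refine intervalIntegral.integral_congr fun t _ => ?_
  simp only [sinDiv_neg]
  ring

/-- Integration by parts, with `sinDiv ρ` as primitive of the cosine; the tail vanishes at `x` and
`sinDiv ρ` at `0`. It converts a sine transform into a cosine transform. -/
theorem integral_tail_mul_cos {f : ℝ → ℂ} (hf : Continuous f) (ρ : ℂ) (x : ℝ) :
    ∫ t in (0 : ℝ)..x, (∫ s in t..x, f s) * Complex.cos (ρ * t) =
      ∫ t in (0 : ℝ)..x, f t * sinDiv ρ t := by
  have hs := continuous_sinDiv ρ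
  have hP : ∀ t, HasDerivAt (fun t => ∫ s in t..x, f s) (-f t) t := fun t =>
    intervalIntegral.integral_hasDerivAt_left (hf.intervalIntegrable _ _)
      hf.stronglyMeasurable.stronglyMeasurableAtFilter hf.continuousAt
  have hPc : Continuous fun t => ∫ s in t..x, f s :=
    continuous_iff_continuousAt.2 fun t => (hP t).continuousAt
  have h := intervalIntegral.integral_eq_sub_of_hasDerivAt (a := 0) (b := x)
    (fun t _ => (hP t).mul (hasDerivAt_sinDiv ρ t))
    (Continuous.intervalIntegrable (by fun_prop) _ _)
  rw [intervalIntegral.integral_add (Continuous.intervalIntegrable (by fun_prop) _ _)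
    (Continuous.intervalIntegrable (by fun_prop) _ _)] at h
  simp only [Pi.mul_apply, intervalIntegral.integral_same, zero_mul, sinDiv_zero_right, mul_zero,
    sub_zero, neg_mul, intervalIntegral.integral_neg] at h
  linear_combination h

/-- The initial slope `h` brings in sine terms that must be rewritten with cosines: `h sinDiv ρ x =
∫₀ˣ h cos(ρt) dt` gives the summand `h` of the kernel, and `integral_tail_mul_cos` applied to the
odd part of `K` gives the tail integral. -/
theorem exists_isKernelG {L : ℝ} (hL : 0 ≤ L) {q : ℝ → ℂ}
    (hq : IntervalIntegrable q volume 0 L) (h : ℂ) : ∃ K, IsKernelG L q h K := by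
  obtain ⟨K, hK, hsol⟩ := exists_transmutation_kernel hL hq
  have hKx : ∀ x, Continuous (K x) := fun x => hK.comp (Continuous.prodMk_right x)
  have hS : ∀ x, Continuous fun t => K x t - K x (-t) := fun x =>
    (hKx x).sub ((hKx x).comp continuous_neg)
  have hC : ∀ x, Continuous fun t => K x t + K x (-t) := fun x =>
    (hKx x).add ((hKx x).comp continuous_neg)
  have hT : ∀ x, Continuous fun t => ∫ s in t..x, (K x s - K x (-s)) := fun x =>
    continuous_integral_interval (f := fun _ s => K x s - K x (-s))
      ((hS x).comp continuous_snd) (by fun_prop) (by fun_prop)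
  refine ⟨fun x t => K x t + K x (-t) + h + h * ∫ s in t..x, (K x s - K x (-s)), fun x _ =>
    (((hC x).add continuous_const).add (continuous_const.mul (hT x))).continuousOn,
    fun ρ => ⟨_, hsol ρ 1 h, ?_⟩⟩
  intro x _
  have hs := continuous_sinDiv ρ
  have hc := continuous_cos_mul ρ
  have hcos : ∫ t in (0 : ℝ)..x, Complex.cos (ρ * t) = sinDiv ρ x := by
    rw [intervalIntegral.integral_eq_sub_of_hasDerivAt (fun t _ => hasDerivAt_sinDiv ρ t)
      (hc.intervalIntegrable _ _)]
    simp
  have e1 : ∫ r in (-x)..x, K x r * (1 * Complex.cos (ρ * r) + h * sinDiv ρ r) =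
      ∫ t in (0 : ℝ)..x, ((K x t + K x (-t)) * Complex.cos (ρ * t) +
        h * ((K x t - K x (-t)) * sinDiv ρ t)) := by
    rw [integral_symmetric_eq
      (f := fun r : ℝ => K x r * (1 * Complex.cos (ρ * r) + h * sinDiv ρ r)) ((hKx x).mul
      ((continuous_const.mul hc).add (continuous_const.mul hs)))]
    refine intervalIntegral.integral_congr fun t _ => ?_
    simp only [sinDiv_neg, cos_mul_neg]
    ring
  have e2 : ∫ t in (0 : ℝ)..x, (K x t + K x (-t) + h + h * ∫ s in t..x, (K x s - K x (-s))) *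
      Complex.cos (ρ * t) = ∫ t in (0 : ℝ)..x, ((K x t + K x (-t)) * Complex.cos (ρ * t) +
        (h * Complex.cos (ρ * t) +
          h * ((∫ s in t..x, (K x s - K x (-s))) * Complex.cos (ρ * t)))) := by
    refine intervalIntegral.integral_congr fun t _ => ?_
    ring
  have i1 : IntervalIntegrable (fun t : ℝ => (K x t + K x (-t)) * Complex.cos (ρ * t))
    volume 0 x := ((hC x).mul hc).intervalIntegrable _ _
  have i2 : IntervalIntegrable (fun t : ℝ => (K x t - K x (-t)) * sinDiv ρ t)
    volume 0 x := ((hS x).mul hs).intervalIntegrable _ _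
  have i3 : IntervalIntegrable (fun t : ℝ =>
    (∫ s in t..x, (K x s - K x (-s))) * Complex.cos (ρ * t)) volume 0 x :=
    ((hT x).mul hc).intervalIntegrable _ _
  have i4 : IntervalIntegrable (fun t : ℝ => Complex.cos (ρ * t)) volume 0 x :=
    hc.intervalIntegrable _ _
  rw [e1, e2, intervalIntegral.integral_add i1 (i2.const_mul _),
    intervalIntegral.integral_add i1 ((i4.const_mul _).add (i3.const_mul _)),
    intervalIntegral.integral_add (i4.const_mul _) (i3.const_mul _)]
  simp only [intervalIntegral.integral_const_mul]
  rw [hcos, integral_tail_mul_cos (hS x)]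
  ring

/-! ### Completeness and orthogonality of the trigonometric systems -/

/-- The even extension of `f` is continuous on the circle of length `2x`, and its Fourier
coefficients are multiples of the cosine coefficients. They are all zero, hence summable, so the
Fourier series converges pointwise to the extension. -/
theorem eq_zero_of_cos_coeff_eq_zero {x : ℝ} (hx : 0 < x) {f : ℝ → ℂ} (hf : Continuous f)
    (h : ∀ n : ℕ, ∫ t in (0 : ℝ)..x, f t * (Real.cos (n * Real.pi * t / x) : ℂ) = 0)
    {t : ℝ} (ht : t ∈ Icc 0 x) : f t = 0 := by
  have hfact : Fact (0 < 2 * x) := ⟨by linarith⟩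
  have hfa : Continuous fun t : ℝ => f |t| := hf.comp continuous_abs
  have hx2 : -x + 2 * x = x := by ring
  have hgc : Continuous (AddCircle.liftIco (2 * x) (-x) fun t => f |t|) := by
    refine AddCircle.liftIco_continuous ?_ hfa.continuousOn
    rw [hx2, abs_neg]
  have hcoeff : ∀ n : ℤ, fourierCoeff (AddCircle.liftIco (2 * x) (-x) fun t => f |t|) n = 0 := by
    intro n
    rw [fourierCoeff_liftIco_eq, fourierCoeffOn_eq_integral]
    refine smul_eq_zero_of_right _ ?_
    simp_rw [fourier_coe_apply, hx2, show x - -x = 2 * x by ring]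
    rw [integral_symmetric_eq (by fun_prop)]
    have key : ∀ t : ℝ, Complex.exp (2 * Real.pi * Complex.I * (-n : ℤ) * t / (2 * x : ℝ)) +
        Complex.exp (2 * Real.pi * Complex.I * (-n : ℤ) * (-t : ℝ) / (2 * x : ℝ)) =
        2 * (Real.cos (n.natAbs * Real.pi * t / x) : ℂ) := by
      intro t
      have hc1 : Real.cos (n.natAbs * Real.pi * t / x) = Real.cos (n * Real.pi * t / x) := by
        rw [Nat.cast_natAbs, Int.cast_abs]
        rcases abs_choice (n : ℝ) with h | h <;> rw [h]
        rw [← Real.cos_neg]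
        congr 1
        ring
      rw [hc1, Complex.ofReal_cos, Complex.cos]
      have hxc : (x : ℂ) ≠ 0 := by exact_mod_cast hx.ne'
      rw [mul_div_cancel₀ _ (two_ne_zero), add_comm]
      congr 2 <;>
      · push_cast
        field_simp
    calc _ = ∫ t in (0 : ℝ)..x, 2 * (f t * (Real.cos (n.natAbs * Real.pi * t / x) : ℂ)) := by
          refine intervalIntegral.integral_congr fun t ht => ?_
          rw [uIcc_of_le hx.le] at ht
          simp only [abs_neg, abs_of_nonneg ht.1, smul_eq_mul]
          rw [← add_mul, key]
          ring
      _ = 0 := by rw [intervalIntegral.integral_const_mul, h, mul_zero]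
  let F : C(AddCircle (2 * x), ℂ) := ⟨_, hgc⟩
  have hF : ∀ n, fourierCoeff F n = 0 := hcoeff
  -- Evaluation takes place at `-t` because the fundamental domain `[-x, x)` omits the endpoint `t =
  -- x`.
  have hsum := has_pointwise_sum_fourier_series_of_summable (f := F)
    (by rw [funext hF]; exact summable_zero) ((-t : ℝ) : AddCircle (2 * x))
  simp only [hF, zero_smul] at hsum
  have h0 := hsum.unique hasSum_zero
  have h1 : F ((-t : ℝ) : AddCircle (2 * x)) = f |-t| :=
    AddCircle.liftIco_coe_apply (f := fun t => f |t|) ⟨by linarith [ht.2], by linarith [ht.1]⟩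
  rw [h1, abs_neg, abs_of_nonneg ht.1] at h0
  exact h0

/-- The product of `sin(πt/(2x))` with a cosine `cos(nπt/x)`, `n ≥ 1`, is half the difference of two
consecutive functions of the sine system; for `n = 0` it is the first of them. So `f(t)
sin(πt/(2x))` has zero cosine coefficients. The factor is positive on `(0, x]`, and `t = 0` follows
by continuity. -/
theorem eq_zero_of_sin_coeff_eq_zero {x : ℝ} (hx : 0 < x) {f : ℝ → ℂ} (hf : Continuous f)
    (h : ∀ n : ℕ, ∫ t in (0 : ℝ)..x,
      f t * (Real.sin ((2 * n + 1) * Real.pi * t / (2 * x)) : ℂ) = 0)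
    {t : ℝ} (ht : t ∈ Icc 0 x) : f t = 0 := by
  have hpos : ∀ t ∈ Ioc 0 x, f t = 0 := by
    intro t ht
    have hz := eq_zero_of_cos_coeff_eq_zero hx
      (f := fun t => f t * (Real.sin (Real.pi * t / (2 * x)) : ℂ)) (by fun_prop) (fun n => ?_)
      (Ioc_subset_Icc_self ht)
    · rcases mul_eq_zero.1 hz with h0 | h0
      · exact h0
      · refine absurd (Complex.ofReal_eq_zero.1 h0) (Real.sin_pos_of_pos_of_lt_pi ?_ ?_).ne'
        · have := Real.pi_pos; have := ht.1; positivity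
        · rw [div_lt_iff₀ (by positivity)]
          nlinarith [Real.pi_pos, ht.1, ht.2]
    · have hI : ∀ n : ℕ, IntervalIntegrable (fun t : ℝ =>
          f t * (Real.sin ((2 * n + 1) * Real.pi * t / (2 * x)) : ℂ)) volume 0 x := fun n =>
        Continuous.intervalIntegrable (by fun_prop) _ _
      rcases n with _ | n
      · simpa using h 0
      · have : ∀ t : ℝ, f t * (Real.sin (Real.pi * t / (2 * x)) : ℂ) *
            (Real.cos ((n + 1 : ℕ) * Real.pi * t / x) : ℂ) =
            1 / 2 * (f t * (Real.sin ((2 * (n + 1 : ℕ) + 1) * Real.pi * t / (2 * x)) : ℂ) -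
              f t * (Real.sin ((2 * n + 1) * Real.pi * t / (2 * x)) : ℂ)) := by
          intro t
          have e : Real.sin (Real.pi * t / (2 * x)) * Real.cos ((n + 1 : ℕ) * Real.pi * t / x) =
              1 / 2 * (Real.sin ((2 * (n + 1 : ℕ) + 1) * Real.pi * t / (2 * x)) -
                Real.sin ((2 * n + 1) * Real.pi * t / (2 * x))) := by
            rw [Real.sin_sub_sin]
            have h1 : ((2 * (n + 1 : ℕ) + 1) * Real.pi * t / (2 * x) -
              (2 * n + 1) * Real.pi * t / (2 * x)) / 2 = Real.pi * t / (2 * x) := by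
              push_cast; field_simp; ring
            have h2 : ((2 * (n + 1 : ℕ) + 1) * Real.pi * t / (2 * x) +
              (2 * n + 1) * Real.pi * t / (2 * x)) / 2 = (n + 1 : ℕ) * Real.pi * t / x := by
              push_cast; field_simp; ring
            rw [h1, h2]
            ring
          rw [mul_assoc, ← Complex.ofReal_mul, e]
          push_cast
          ring
        simp_rw [this]
        rw [intervalIntegral.integral_const_mul, intervalIntegral.integral_sub (hI (n + 1)) (hI n),
          h, h, sub_zero, mul_zero]
  have hcl : closure (Ioc 0 x) = Icc 0 x := closure_Ioc hx.ne
  have : EqOn f 0 (closure (Ioc 0 x)) :=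
    Set.EqOn.closure (fun t ht => hpos t ht) hf continuous_const
  exact this (by rwa [hcl])

theorem integral_cos_int_mul {x : ℝ} (hx : 0 < x) (k : ℤ) :
    ∫ t in (0 : ℝ)..x, Real.cos (k * Real.pi * t / x) = if k = 0 then x else 0 := by
  split_ifs with hk
  · simp [hk]
  · have hk' : (k : ℝ) ≠ 0 := by exact_mod_cast hk
    have hc : k * Real.pi / x ≠ 0 := by have := Real.pi_ne_zero; positivity
    have : ∀ t, Real.cos (k * Real.pi * t / x) = Real.cos (k * Real.pi / x * t) := fun t => by
      congr 1; ring
    simp_rw [this]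
    rw [intervalIntegral.integral_comp_mul_left _ hc, integral_cos, mul_zero, Real.sin_zero,
      div_mul_cancel₀ _ hx.ne', Real.sin_int_mul_pi, sub_zero, smul_zero]

theorem integral_cos_mul_cos {x : ℝ} (hx : 0 < x) (n m : ℕ) :
    ∫ t in (0 : ℝ)..x, Real.cos (n * Real.pi * t / x) * Real.cos (m * Real.pi * t / x) =
      if n = m then (if n = 0 then x else x / 2) else 0 := by
  have : ∀ t, Real.cos (n * Real.pi * t / x) * Real.cos (m * Real.pi * t / x) =
      1 / 2 * (Real.cos (((n - m : ℤ) : ℝ) * Real.pi * t / x) +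
        Real.cos (((n + m : ℤ) : ℝ) * Real.pi * t / x)) := by
    intro t
    rw [Real.cos_add_cos]
    have h1 : (((n - m : ℤ) : ℝ) * Real.pi * t / x + ((n + m : ℤ) : ℝ) * Real.pi * t / x) / 2 =
      n * Real.pi * t / x := by push_cast; ring
    have h2 : (((n - m : ℤ) : ℝ) * Real.pi * t / x - ((n + m : ℤ) : ℝ) * Real.pi * t / x) / 2 =
      -(m * Real.pi * t / x) := by push_cast; ring
    rw [h1, h2, Real.cos_neg]
    ring
  simp_rw [this]
  rw [intervalIntegral.integral_const_mul, intervalIntegral.integral_add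
    (Continuous.intervalIntegrable (by fun_prop) _ _)
    (Continuous.intervalIntegrable (by fun_prop) _ _), integral_cos_int_mul hx,
    integral_cos_int_mul hx]
  split_ifs <;> first | omega | ring

theorem integral_sin_mul_sin {x : ℝ} (hx : 0 < x) (n m : ℕ) :
    ∫ t in (0 : ℝ)..x, Real.sin ((2 * n + 1) * Real.pi * t / (2 * x)) *
      Real.sin ((2 * m + 1) * Real.pi * t / (2 * x)) = if n = m then x / 2 else 0 := by
  have : ∀ t, Real.sin ((2 * n + 1) * Real.pi * t / (2 * x)) *
      Real.sin ((2 * m + 1) * Real.pi * t / (2 * x)) =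
      1 / 2 * (Real.cos (((n - m : ℤ) : ℝ) * Real.pi * t / x) -
        Real.cos (((n + m + 1 : ℤ) : ℝ) * Real.pi * t / x)) := by
    intro t
    rw [Real.cos_sub_cos]
    have h1 : (((n - m : ℤ) : ℝ) * Real.pi * t / x + ((n + m + 1 : ℤ) : ℝ) * Real.pi * t / x) / 2 =
      (2 * n + 1) * Real.pi * t / (2 * x) := by push_cast; field_simp; ring
    have h2 : (((n - m : ℤ) : ℝ) * Real.pi * t / x - ((n + m + 1 : ℤ) : ℝ) * Real.pi * t / x) / 2 =
      -((2 * m + 1) * Real.pi * t / (2 * x)) := by push_cast; field_simp; ring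
    rw [h1, h2, Real.sin_neg]
    ring
  simp_rw [this]
  rw [intervalIntegral.integral_const_mul, intervalIntegral.integral_sub
    (Continuous.intervalIntegrable (by fun_prop) _ _)
    (Continuous.intervalIntegrable (by fun_prop) _ _), integral_cos_int_mul hx,
    integral_cos_int_mul hx]
  split_ifs <;> first | omega | ring

/-- A continuous function whose coefficients with respect to a complete orthogonal system of
functions bounded by `1` are absolutely summable is the sum of its series. -/
theorem sumsAbsolutelyUniformlyOn_of_orthogonal {x : ℝ} (hx : 0 < x) {e : ℕ → ℝ → ℝ}
    (hec : ∀ n, Continuous (e n)) (he : ∀ n t, |e n t| ≤ 1) {w : ℕ → ℝ}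
    (horth : ∀ n m, ∫ t in (0 : ℝ)..x, e n t * e m t = if n = m then w n else 0)
    (hcomplete : ∀ f : ℝ → ℂ, Continuous f → (∀ n, ∫ t in (0 : ℝ)..x, f t * (e n t : ℂ) = 0) →
      ∀ t ∈ Icc 0 x, f t = 0)
    {f : ℝ → ℂ} (hf : ContinuousOn f (Icc 0 x)) {a : ℕ → ℂ} (ha : Summable fun n => ‖a n‖)
    (hfa : ∀ n, ∫ t in (0 : ℝ)..x, f t * (e n t : ℂ) = a n * w n) :
    SumsAbsolutelyUniformlyOn (fun n t => a n * (e n t : ℂ)) f (Icc 0 x) := by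
  have hbound : ∀ n t, ‖a n * (e n t : ℂ)‖ ≤ ‖a n‖ := fun n t => by
    rw [norm_mul, Complex.norm_real]
    exact mul_le_of_le_one_right (norm_nonneg _) (he n t)
  have hterm : ∀ n, Continuous fun t => a n * (e n t : ℂ) := fun n => by
    have := hec n
    fun_prop
  set g : ℝ → ℂ := fun t => ∑' n, a n * (e n t : ℂ) with hg
  have hgc : Continuous g := continuous_tsum hterm ha hbound
  have hgcoeff : ∀ m, ∫ t in (0 : ℝ)..x, g t * (e m t : ℂ) = a m * w m := by
    intro m
    have hm := hec m
    have h1 : HasSum (fun n => ∫ t in (0 : ℝ)..x, a n * (e n t : ℂ) * (e m t : ℂ))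
        (∫ t in (0 : ℝ)..x, g t * (e m t : ℂ)) := by
      refine intervalIntegral.hasSum_integral_of_dominated_convergence (fun n _ => ‖a n‖)
        (fun n => ((hterm n).mul (Complex.continuous_ofReal.comp hm)).aestronglyMeasurable)
        (fun n => Eventually.of_forall fun t _ => ?_)
        (Eventually.of_forall fun t _ => ha) (continuous_const.intervalIntegrable _ _)
        (Eventually.of_forall fun t _ => ?_)
      · rw [norm_mul, Complex.norm_real]
        exact (mul_le_of_le_one_right (norm_nonneg _) (he m t)).trans (hbound n t)
      · exact (Summable.of_norm_bounded ha fun n => hbound n t).hasSum.mul_right _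
    have h2 : ∀ n, ∫ t in (0 : ℝ)..x, a n * (e n t : ℂ) * (e m t : ℂ) =
        if n = m then a m * w m else 0 := by
      intro n
      simp_rw [mul_assoc, ← Complex.ofReal_mul]
      rw [intervalIntegral.integral_const_mul, intervalIntegral.integral_ofReal, horth]
      split_ifs with h
      · rw [h]
      · simp
    simp_rw [h2] at h1
    exact h1.unique (hasSum_ite_eq m _)
  have hfg : ∀ t ∈ Icc 0 x, f t = g t := by
    -- `hcomplete` requires continuity on the whole line, whereas `f` is continuous only on `[0,
    -- x]`.
    set f' : ℝ → ℂ := IccExtend hx.le ((Icc 0 x).domRestrict f) with hf'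
    have hf'c : Continuous f' := (continuousOn_iff_continuous_domRestrict.1 hf).Icc_extend'
    have hff' : ∀ t ∈ Icc 0 x, f' t = f t := fun t ht => IccExtend_of_mem hx.le _ ht
    intro t ht
    have := hcomplete (fun t => f' t - g t) (hf'c.sub hgc) (fun n => ?_) t ht
    · rw [← hff' t ht]
      exact sub_eq_zero.1 this
    · have hn := hec n
      simp_rw [sub_mul]
      rw [intervalIntegral.integral_sub (Continuous.intervalIntegrable (by fun_prop) _ _)
        (Continuous.intervalIntegrable (by fun_prop) _ _), hgcoeff, ← hfa, sub_eq_zero]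
      refine intervalIntegral.integral_congr fun t ht => ?_
      rw [uIcc_of_le hx.le] at ht
      simp only [hff' t ht]
  refine ⟨fun t _ => Summable.of_nonneg_of_le (fun n => norm_nonneg _) (fun n => hbound n t) ha, ?_⟩
  exact (tendstoUniformlyOn_tsum_nat ha fun n t _ => hbound n t).congr_right
    fun t ht => (hfg t ht).symm

/-! ### Square summability of the Fourier sine coefficients -/

/-- Parseval for the extension of `q` by zero to `(-x, x]`: the sine coefficient is `i x (c_n -
c_{-n})`, and `‖a - b‖² ≤ 2(‖a‖² + ‖b‖²)`. -/
theorem summable_norm_sq_sin_coeff {x : ℝ} (hx : 0 < x) {q : ℝ → ℂ}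
    (hq : MemLp q 2 (volume.restrict (Ioc 0 x))) :
    Summable fun n : ℕ => ‖∫ t in (0 : ℝ)..x, q t * (Real.sin (n * Real.pi * t / x) : ℂ)‖ ^ 2 := by
  have hxx : -x < x := by linarith
  have hq0 : MemLp ((Ioc 0 x).indicator q) 2 (volume.restrict (Ioc (-x) x)) := by
    rw [memLp_indicator_iff_restrict measurableSet_Ioc, Measure.restrict_restrict measurableSet_Ioc,
      inter_eq_left.2 (Ioc_subset_Ioc_left (by linarith))]
    exact hq
  have hsum := (hasSum_sq_fourierCoeffOn hxx hq0).summable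
  have hqi : IntervalIntegrable q volume 0 x := by
    rw [intervalIntegrable_iff_integrableOn_Ioc_of_le hx.le]
    exact hq.integrable one_le_two
  set c : ℤ → ℂ := fourierCoeffOn hxx ((Ioc 0 x).indicator q) with hc
  have hcn : ∀ n : ℤ, ∫ t in (0 : ℝ)..x,
      q t * Complex.exp (-(n * Real.pi * t / x * Complex.I)) = 2 * x * c n := by
    intro n
    rw [hc, fourierCoeffOn_eq_integral, intervalIntegral.integral_of_le hx.le,
      intervalIntegral.integral_of_le hxx.le]
    have e : ∀ t : ℝ, (fourier (-n) (t : AddCircle (x - -x)) : ℂ) • (Ioc 0 x).indicator q t =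
        (Ioc 0 x).indicator
          (fun t => q t * Complex.exp (-(n * Real.pi * t / x * Complex.I))) t := by
      intro t
      by_cases ht : t ∈ Ioc 0 x
      · rw [indicator_of_mem ht, indicator_of_mem ht, fourier_coe_apply, smul_eq_mul, mul_comm]
        have hxc : (x : ℂ) ≠ 0 := by exact_mod_cast hx.ne'
        congr 2
        push_cast
        field_simp
        ring
      · rw [indicator_of_notMem ht, indicator_of_notMem ht, smul_zero]
    simp_rw [e]
    rw [setIntegral_indicator measurableSet_Ioc,
      inter_eq_right.2 (Ioc_subset_Ioc_left (by linarith)), Complex.real_smul, ← mul_assoc]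
    have hxc : (x : ℂ) ≠ 0 := by exact_mod_cast hx.ne'
    push_cast
    rw [show (2 * x * (1 / (x - -x)) : ℂ) = 1 by field_simp; ring, one_mul]
  have hs : ∀ n : ℕ, ∫ t in (0 : ℝ)..x, q t * (Real.sin (n * Real.pi * t / x) : ℂ) =
      Complex.I * x * (c n - c (-n : ℤ)) := by
    intro n
    have hI : ∀ n : ℤ, IntervalIntegrable (fun t : ℝ =>
        q t * Complex.exp (-(n * Real.pi * t / x * Complex.I))) volume 0 x := fun n =>
      hqi.mul_continuousOn (Continuous.continuousOn (by fun_prop))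
    have : ∀ t : ℝ, q t * (Real.sin (n * Real.pi * t / x) : ℂ) = Complex.I / 2 *
        (q t * Complex.exp (-((n : ℤ) * Real.pi * t / x * Complex.I)) -
          q t * Complex.exp (-((-n : ℤ) * Real.pi * t / x * Complex.I))) := by
      intro t
      rw [Complex.ofReal_sin, Complex.sin]
      push_cast
      rw [show -((-n : ℂ) * Real.pi * t / x * Complex.I) = n * Real.pi * t / x * Complex.I by ring,
        neg_mul]
      ring
    simp_rw [this]
    rw [intervalIntegral.integral_const_mul, intervalIntegral.integral_sub (hI _) (hI _), hcn, hcn]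
    ring
  have h1 : Summable fun n : ℕ => ‖c n‖ ^ 2 := hsum.comp_injective Nat.cast_injective
  have h2 : Summable fun n : ℕ => ‖c (-n : ℤ)‖ ^ 2 :=
    hsum.comp_injective (neg_injective.comp Nat.cast_injective)
  refine Summable.of_nonneg_of_le (fun n => sq_nonneg _) (fun n => ?_)
    ((h1.add h2).mul_left (2 * x ^ 2))
  rw [hs, norm_mul, norm_mul, Complex.norm_I, Complex.norm_real, Real.norm_of_nonneg hx.le,
    one_mul, mul_pow, mul_comm (2 : ℝ), mul_assoc]
  refine mul_le_mul_of_nonneg_left ?_ (sq_nonneg x)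
  have h3 := norm_sub_le (c n) (c (-n : ℤ))
  nlinarith [norm_nonneg (c n - c (-n : ℤ)), sq_nonneg (‖c n‖ - ‖c (-n : ℤ)‖),
    norm_nonneg (c n), norm_nonneg (c (-n : ℤ))]

/-! ### Asymptotics of the coefficients -/

theorem norm_integral_bounded_mul_le {L : ℝ} {q : ℝ → ℂ}
    (hq : IntervalIntegrable q volume 0 L) {x : ℝ} (hx : x ∈ Icc 0 L) {s u : ℝ → ℂ} {A B : ℝ}
    (hA : 0 ≤ A) (hs : ∀ t ∈ Icc 0 x, ‖s t‖ ≤ A) (hu : ∀ t ∈ Icc 0 x, ‖u t‖ ≤ B) :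
    ‖∫ t in (0 : ℝ)..x, s t * (q t * u t)‖ ≤ A * (∫ t in (0 : ℝ)..L, ‖q t‖) * B := by
  have hL : 0 ≤ L := hx.1.trans hx.2
  have hB : 0 ≤ B := (norm_nonneg _).trans (hu 0 ⟨le_rfl, hx.1⟩)
  have hsub : uIcc 0 x ⊆ uIcc 0 L := by
    rw [uIcc_of_le hx.1, uIcc_of_le hL]; exact Icc_subset_Icc le_rfl hx.2
  have h1 : ‖∫ t in (0 : ℝ)..x, s t * (q t * u t)‖ ≤ ∫ t in (0 : ℝ)..x, A * B * ‖q t‖ := by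
    refine intervalIntegral.norm_integral_le_of_norm_le hx.1 (Eventually.of_forall fun t ht => ?_)
      ((hq.mono_set hsub).norm.const_mul _)
    have ht' := Ioc_subset_Icc_self ht
    rw [norm_mul, norm_mul]
    calc ‖s t‖ * (‖q t‖ * ‖u t‖) ≤ A * (‖q t‖ * B) := by
          gcongr
          · exact hs t ht'
          · exact hu t ht'
      _ = _ := by ring
  rw [intervalIntegral.integral_const_mul] at h1
  have h2 : ∫ t in (0 : ℝ)..x, ‖q t‖ ≤ ∫ t in (0 : ℝ)..L, ‖q t‖ :=
    intervalIntegral.integral_mono_interval le_rfl hx.1 hx.2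
      (Eventually.of_forall fun t => norm_nonneg _) hq.norm
  calc _ ≤ A * B * ∫ t in (0 : ℝ)..x, ‖q t‖ := h1
    _ ≤ A * B * ∫ t in (0 : ℝ)..L, ‖q t‖ := by gcongr
    _ = _ := by ring

theorem norm_sin_ofReal_mul_le (ρ t : ℝ) : ‖Complex.sin ((ρ : ℂ) * t)‖ ≤ 1 := by
  rw [← Complex.ofReal_mul, ← Complex.ofReal_sin, Complex.norm_real]
  exact Real.abs_sin_le_one _

theorem norm_cos_ofReal_mul_le (ρ t : ℝ) : ‖Complex.cos ((ρ : ℂ) * t)‖ ≤ 1 := by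
  rw [← Complex.ofReal_mul, ← Complex.ofReal_cos, Complex.norm_real]
  exact Real.abs_cos_le_one _

theorem norm_sinDiv_ofReal_le {ρ : ℝ} (hρ : 0 < ρ) (t : ℝ) : ‖sinDiv ρ t‖ ≤ 1 / ρ := by
  have h := norm_sin_ofReal_mul_le ρ t
  rw [← mul_sinDiv, norm_mul, Complex.norm_real, Real.norm_of_nonneg hρ.le] at h
  rwa [le_div_iff₀ hρ, mul_comm]

/-- First-order asymptotics of solutions of the Volterra equation for large real `ρ`. -/
theorem norm_volterra_sub_le {L : ℝ} (hL : 0 ≤ L) {q : ℝ → ℂ}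
    (hq : IntervalIntegrable q volume 0 L) {ρ : ℝ} (hρ0 : 0 < ρ)
    (hρ : 2 * (∫ t in (0 : ℝ)..L, ‖q t‖) ≤ ρ) {m y : ℝ → ℂ} (hm : ContinuousOn m (Icc 0 L))
    (hy : ContinuousOn y (Icc 0 L))
    (heq : ∀ x ∈ Icc 0 L, y x = m x + ∫ t in (0 : ℝ)..x, sinDiv ρ (x - t) * (q t * y t))
    {M₀ : ℝ} (hM₀ : ∀ x ∈ Icc 0 L, ‖m x‖ ≤ M₀) {x : ℝ} (hx : x ∈ Icc 0 L) :
    ‖y x - m x‖ ≤ (‖∫ t in (0 : ℝ)..x, Complex.sin (ρ * (x - t : ℝ)) * (q t * m t)‖) / ρ +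
      2 * (∫ t in (0 : ℝ)..L, ‖q t‖) ^ 2 * M₀ / ρ ^ 2 := by
  set N := ∫ t in (0 : ℝ)..L, ‖q t‖ with hN
  have hN0 : 0 ≤ N := intervalIntegral.integral_nonneg hL fun t _ => norm_nonneg _
  have hs : ∀ x t : ℝ, ‖sinDiv ρ (x - t)‖ ≤ 1 / ρ := fun x t => norm_sinDiv_ofReal_le hρ0 _
  -- At a maximum point of `‖y‖` the equation gives `‖y‖ ≤ M₀ + ½‖y‖`, because `N/ρ ≤ 1/2`.
  have hyM : ∀ x ∈ Icc 0 L, ‖y x‖ ≤ 2 * M₀ := by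
    obtain ⟨x₀, hx₀, hmax⟩ := isCompact_Icc.exists_isMaxOn (nonempty_Icc.2 hL) hy.norm
    have hmax' : ∀ x ∈ Icc 0 L, ‖y x‖ ≤ ‖y x₀‖ := fun x hx => hmax hx
    have h1 : ‖y x₀‖ ≤ M₀ + 1 / ρ * N * ‖y x₀‖ := by
      conv_lhs => rw [heq x₀ hx₀]
      refine (norm_add_le _ _).trans (add_le_add (hM₀ x₀ hx₀) ?_)
      exact norm_integral_bounded_mul_le hq hx₀ (by positivity) (fun t _ => hs x₀ t)
        fun t ht => hmax' t ⟨ht.1, ht.2.trans hx₀.2⟩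
    have h2 : 1 / ρ * N ≤ 1 / 2 := by
      rw [one_div_mul_eq_div, div_le_iff₀ hρ0]
      linarith
    have h3 : 1 / ρ * N * ‖y x₀‖ ≤ 1 / 2 * ‖y x₀‖ := by gcongr
    exact fun x hx => (hmax' x hx).trans (by linarith)
  have hdiff : ∀ x ∈ Icc 0 L, ‖y x - m x‖ ≤ 1 / ρ * N * (2 * M₀) := by
    intro x hx
    rw [heq x hx, add_sub_cancel_left]
    exact norm_integral_bounded_mul_le hq hx (by positivity) (fun t _ => hs x t)
      fun t ht => hyM t ⟨ht.1, ht.2.trans hx.2⟩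
  have hsub : Icc 0 x ⊆ Icc 0 L := Icc_subset_Icc le_rfl hx.2
  have hqx : IntervalIntegrable q volume 0 x :=
    hq.mono_set (by rwa [uIcc_of_le hx.1, uIcc_of_le hL])
  have hcs : Continuous fun t => sinDiv ρ (x - t) :=
    (continuous_sinDiv ρ).comp (continuous_const.sub continuous_id)
  have hI : ∀ u : ℝ → ℂ, ContinuousOn u (Icc 0 L) →
      IntervalIntegrable (fun t => sinDiv ρ (x - t) * (q t * u t)) volume 0 x := fun u hu =>
    (hqx.mul_continuousOn (by rw [uIcc_of_le hx.1]; exact hu.mono hsub)).continuousOn_mul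
      hcs.continuousOn
  have hρc : (ρ : ℂ) ≠ 0 := by exact_mod_cast hρ0.ne'
  -- The oscillation of the first term is kept for later use. The second is estimated crudely: each
  -- of the two Volterra integrations costs a factor `N/ρ`.
  have hsplit : y x - m x = (∫ t in (0 : ℝ)..x, sinDiv ρ (x - t) * (q t * m t)) +
      ∫ t in (0 : ℝ)..x, sinDiv ρ (x - t) * (q t * (y t - m t)) := by
    rw [heq x hx, add_sub_cancel_left, ← intervalIntegral.integral_add (hI m hm)
      (hI (fun t => y t - m t) (hy.sub hm))]
    refine intervalIntegral.integral_congr fun t _ => ?_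
    ring
  have hmain : ∫ t in (0 : ℝ)..x, sinDiv ρ (x - t) * (q t * m t) =
      (∫ t in (0 : ℝ)..x, Complex.sin (ρ * (x - t : ℝ)) * (q t * m t)) / ρ := by
    rw [eq_div_iff hρc, mul_comm, ← intervalIntegral.integral_const_mul]
    refine intervalIntegral.integral_congr fun t _ => ?_
    simp only [← mul_sinDiv]
    ring
  rw [hsplit, hmain]
  refine (norm_add_le _ _).trans (add_le_add ?_ ?_)
  · rw [norm_div, Complex.norm_real, Real.norm_of_nonneg hρ0.le]
  · refine (norm_integral_bounded_mul_le hq hx (by positivity) (fun t _ => hs x t)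
      fun t ht => hdiff t (hsub ht)).trans (le_of_eq ?_)
    rw [← hN]
    field_simp

/-- `F/ρ ≤ F² + 1/ρ²`, and `1/ρ_n²` is dominated by a multiple of `1/n²`. Only large `n` matter, so
the estimate may be restricted to `ρ n ≥ R`. -/
theorem summable_norm_of_asymptotics {c : ℝ} (hc : 0 < c) {ρ : ℕ → ℝ} (hρ : ∀ n, n * c ≤ ρ n)
    {A : ℕ → ℂ} {F : ℕ → ℝ} (hF : Summable fun n => F n ^ 2) {R C : ℝ} (hC : 0 ≤ C)
    (hA : ∀ n, R ≤ ρ n → ‖A n‖ ≤ F n / ρ n + C / ρ n ^ 2) : Summable fun n => ‖A n‖ := by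
  have hs : Summable fun n : ℕ => F n ^ 2 + (1 + C) / c ^ 2 * (1 / (n : ℝ) ^ 2) :=
    hF.add ((Real.summable_one_div_nat_pow.2 one_lt_two).mul_left _)
  refine Summable.of_norm_bounded_eventually_nat hs ?_
  filter_upwards [eventually_ge_atTop (max 1 ⌈R / c⌉₊)] with n hn
  have hn1 : (1 : ℝ) ≤ n := by exact_mod_cast (le_max_left _ _).trans hn
  have hnR : R / c ≤ n := (Nat.le_ceil _).trans (by exact_mod_cast (le_max_right _ _).trans hn)
  have hnc : 0 < n * c := by positivity
  have hρn : 0 < ρ n := hnc.trans_le (hρ n)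
  have h1 := hA n (((div_le_iff₀ hc).1 hnR).trans (hρ n))
  have h2 : 1 / ρ n ^ 2 ≤ 1 / (n * c) ^ 2 := by
    gcongr
    exact hρ n
  have h3 : F n / ρ n ≤ F n ^ 2 + 1 / ρ n ^ 2 := by
    have : 1 / ρ n ^ 2 = (1 / ρ n) ^ 2 := by ring
    rw [this, div_eq_mul_one_div]
    nlinarith [sq_nonneg (F n - 1 / ρ n), sq_nonneg (F n), sq_nonneg (1 / ρ n)]
  rw [norm_norm]
  calc ‖A n‖ ≤ F n / ρ n + C / ρ n ^ 2 := h1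
    _ ≤ F n ^ 2 + 1 / ρ n ^ 2 + C / ρ n ^ 2 := by linarith
    _ = F n ^ 2 + (1 + C) * (1 / ρ n ^ 2) := by ring
    _ ≤ F n ^ 2 + (1 + C) * (1 / (n * c) ^ 2) := by gcongr
    _ = _ := by field_simp

/-- With `a = ρ_n x` and `b = ρ_n t`, the part of the product constant in `t` drops out at the node
and only frequency `2ρ_n` remains. Integrated against `q`, this is a Fourier sine coefficient on
`[0, x]`. The next lemma plays the same role for the cosine system. -/
theorem sin_sub_mul_of_cos_eq_zero {a b : ℂ} (ha : Complex.cos a = 0) :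
    Complex.sin (a - b) * Complex.sin b = Complex.sin a * (Complex.sin (2 * b) / 2) := by
  rw [Complex.sin_sub, ha, Complex.sin_two_mul]
  ring

theorem sin_sub_mul_of_sin_eq_zero {a b : ℂ} (ha : Complex.sin a = 0) :
    Complex.sin (a - b) * Complex.cos b = -Complex.cos a * (Complex.sin (2 * b) / 2) := by
  rw [Complex.sin_sub, ha, Complex.sin_two_mul]
  ring

theorem memLp_Ioc_of_Icc {L x : ℝ} {q : ℝ → ℂ} (hq : MemLp q 2 (volume.restrict (Icc 0 L)))
    (hx : x ≤ L) : MemLp q 2 (volume.restrict (Ioc 0 x)) :=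
  hq.mono_measure (Measure.restrict_mono
    ((Ioc_subset_Ioc_right hx).trans Ioc_subset_Icc_self) le_rfl)

theorem intervalIntegrable_of_memLp {L : ℝ} (hL : 0 ≤ L) {q : ℝ → ℂ}
    (hq : MemLp q 2 (volume.restrict (Icc 0 L))) : IntervalIntegrable q volume 0 L := by
  rw [intervalIntegrable_iff_integrableOn_Ioc_of_le hL]
  exact (memLp_Ioc_of_Icc hq le_rfl).integrable one_le_two

/-- The coefficient is `ρ_n` times the difference between the solution and its free term. The factor
`ρ_n` is harmless because the free term is itself of size `1/ρ_n`: `norm_volterra_sub_le` applies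
with `M₀ = 1/ρ_n`. -/
theorem summable_norm_kernelS_coeff {L : ℝ} {q : ℝ → ℂ}
    (hq : MemLp q 2 (volume.restrict (Icc 0 L))) {K : ℝ → ℝ → ℂ} (hK : IsKernelS L q K) {x : ℝ}
    (hx : x ∈ Ioc 0 L) :
    Summable fun n : ℕ => ‖∫ t in (0 : ℝ)..x,
      K x t * (Real.sin ((2 * n + 1) * Real.pi * t / (2 * x)) : ℂ)‖ := by
  have hx' := Ioc_subset_Icc_self hx
  have hL : 0 ≤ L := hx'.1.trans hx'.2
  have hqi := intervalIntegrable_of_memLp hL hq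
  have hx0 : 0 < x := hx.1
  have hpi := Real.pi_pos
  set N := ∫ t in (0 : ℝ)..L, ‖q t‖ with hN
  set ρ : ℕ → ℝ := fun n => (2 * n + 1) * Real.pi / (2 * x) with hρ
  have hρpos : ∀ n, 0 < ρ n := fun n => by positivity
  set G : ℕ → ℝ := fun n =>
    ‖∫ t in (0 : ℝ)..x, q t * (Real.sin (n * Real.pi * t / x) : ℂ)‖ with hG
  have hGs : Summable fun n => G n ^ 2 :=
    summable_norm_sq_sin_coeff hx.1 (memLp_Ioc_of_Icc hq hx.2)
  have hGs' : Summable fun n : ℕ => G (2 * n + 1) ^ 2 :=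
    hGs.comp_injective (i := fun n : ℕ => 2 * n + 1) fun a b h => by simpa using h
  refine summable_norm_of_asymptotics (c := Real.pi / x) (by positivity) (ρ := ρ) (fun n => ?_)
    hGs' (R := 2 * N) (C := 2 * N ^ 2) (by positivity) (fun n hn => ?_)
  · rw [hρ]
    simp only
    rw [mul_div_assoc', div_le_div_iff₀ hx.1 (by positivity)]
    nlinarith [mul_pos hpi hx0]
  · obtain ⟨S, hS, hSK⟩ := hK.2 (ρ n)
    have hρc : (ρ n : ℂ) ≠ 0 := by exact_mod_cast (hρpos n).ne'
    have hint : ∫ t in (0 : ℝ)..x, K x t * (Real.sin ((2 * n + 1) * Real.pi * t / (2 * x)) : ℂ) =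
        ρ n * (S x - sinDiv (ρ n) x) := by
      rw [hSK x hx', add_sub_cancel_left, ← intervalIntegral.integral_const_mul]
      refine intervalIntegral.integral_congr fun t _ => ?_
      rw [mul_left_comm, mul_sinDiv, ← Complex.ofReal_mul, ← Complex.ofReal_sin]
      congr 3
      rw [hρ]
      ring
    have hvol := norm_volterra_sub_le hL hqi (hρpos n) hn (continuous_sinDiv (ρ n)).continuousOn
      hS.continuousOn (fun x hx => by simpa using hS.eq_integral hL hqi hx)
      (fun x _ => norm_sinDiv_ofReal_le (hρpos n) x) hx'
    have hcos : Complex.cos (ρ n * x) = 0 := by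
      rw [Complex.cos_eq_zero_iff]
      refine ⟨n, ?_⟩
      rw [hρ]
      have : (x : ℂ) ≠ 0 := by exact_mod_cast hx0.ne'
      push_cast
      field_simp
    have hmain : ‖∫ t in (0 : ℝ)..x, Complex.sin (ρ n * (x - t : ℝ)) * (q t * sinDiv (ρ n) t)‖ ≤
        G (2 * n + 1) / ρ n := by
      have : ∫ t in (0 : ℝ)..x, Complex.sin (ρ n * (x - t : ℝ)) * (q t * sinDiv (ρ n) t) =
          Complex.sin (ρ n * x) / (2 * ρ n) * ∫ t in (0 : ℝ)..x,
            q t * (Real.sin ((2 * n + 1 : ℕ) * Real.pi * t / x) : ℂ) := by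
        rw [← intervalIntegral.integral_const_mul]
        refine intervalIntegral.integral_congr fun t _ => ?_
        have h1 := sin_sub_mul_of_cos_eq_zero (b := ρ n * t) hcos
        have h2 : (Real.sin ((2 * n + 1 : ℕ) * Real.pi * t / x) : ℂ) =
            Complex.sin (2 * (ρ n * t)) := by
          rw [Complex.ofReal_sin, hρ]
          congr 1
          push_cast
          field_simp
        rw [h2]
        rw [← mul_sinDiv _ t, ← mul_sub, ← Complex.ofReal_sub] at h1
        -- The sine is made opaque so that `field_simp` cannot rewrite its argument.
        generalize Complex.sin (2 * ((ρ n : ℂ) * t)) = W at h1 ⊢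
        field_simp
        linear_combination (2 * q t) * h1
      rw [this, norm_mul, norm_div, norm_mul, Complex.norm_real, Real.norm_of_nonneg (hρpos n).le]
      have h3 := norm_sin_ofReal_mul_le (ρ n) x
      have h4 := hρpos n
      calc _ ≤ 1 / (1 * ρ n) * G (2 * n + 1) := by
            gcongr
            norm_num
        _ = _ := by ring
    rw [hint, norm_mul, Complex.norm_real, Real.norm_of_nonneg (hρpos n).le]
    have h4 := hρpos n
    calc _ ≤ ρ n * (G (2 * n + 1) / ρ n / ρ n + 2 * N ^ 2 * (1 / ρ n) / ρ n ^ 2) := by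
          refine mul_le_mul_of_nonneg_left (hvol.trans ?_) h4.le
          gcongr
      _ = _ := by field_simp

theorem summable_norm_kernelG_coeff {L : ℝ} {q : ℝ → ℂ}
    (hq : MemLp q 2 (volume.restrict (Icc 0 L))) {h : ℂ} {K : ℝ → ℝ → ℂ}
    (hK : IsKernelG L q h K) {x : ℝ} (hx : x ∈ Ioc 0 L) :
    Summable fun n : ℕ => ‖∫ t in (0 : ℝ)..x,
      K x t * (Real.cos (n * Real.pi * t / x) : ℂ)‖ := by
  have hx' := Ioc_subset_Icc_self hx
  have hL : 0 ≤ L := hx'.1.trans hx'.2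
  have hqi := intervalIntegrable_of_memLp hL hq
  have hx0 : 0 < x := hx.1
  have hpi := Real.pi_pos
  set N := ∫ t in (0 : ℝ)..L, ‖q t‖ with hN
  have hN0 : 0 ≤ N := intervalIntegral.integral_nonneg hL fun t _ => norm_nonneg _
  set ρ : ℕ → ℝ := fun n => n * Real.pi / x with hρ
  set G : ℕ → ℝ := fun n =>
    ‖∫ t in (0 : ℝ)..x, q t * (Real.sin (n * Real.pi * t / x) : ℂ)‖ with hG
  have hGs : Summable fun n => G n ^ 2 :=
    summable_norm_sq_sin_coeff hx.1 (memLp_Ioc_of_Icc hq hx.2)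
  have hGs' : Summable fun n : ℕ => G (2 * n) ^ 2 :=
    hGs.comp_injective (i := fun n : ℕ => 2 * n) fun a b h => by simpa using h
  -- The choice `R = 2N + 1` forces `ρ n ≥ 1`. This excludes `n = 0`, where `ρ n = 0`, and bounds
  -- the free term by `M₀ = 1 + ‖h‖`.
  refine summable_norm_of_asymptotics (c := Real.pi / x) (by positivity) (ρ := ρ) (fun n => ?_)
    hGs' (R := 2 * N + 1) (C := ‖h‖ * N + 2 * N ^ 2 * (1 + ‖h‖)) (by positivity) (fun n hn => ?_)
  · rw [hρ, mul_div_assoc']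
  · have hρ1 : 1 ≤ ρ n := by linarith
    have hρpos : 0 < ρ n := by linarith
    obtain ⟨φ, hφ, hφK⟩ := hK.2 (ρ n)
    have hρc : (ρ n : ℂ) ≠ 0 := by exact_mod_cast hρpos.ne'
    have hsin : Complex.sin (ρ n * x) = 0 := by
      rw [Complex.sin_eq_zero_iff]
      refine ⟨n, ?_⟩
      rw [hρ]
      have : (x : ℂ) ≠ 0 := by exact_mod_cast hx0.ne'
      push_cast
      field_simp
    -- The node removes `h sin(ρx)/ρ` from the free term at `x`, so the coefficient is exactly `φ x
    -- - m x`.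
    have hsd : sinDiv (ρ n) x = 0 := by
      have := mul_sinDiv (ρ n) x
      rw [hsin] at this
      exact (mul_eq_zero.1 this).resolve_left hρc
    set m : ℝ → ℂ := fun x => 1 * Complex.cos (ρ n * x) + h * sinDiv (ρ n) x with hm
    have hmc : Continuous m :=
      (continuous_const.mul (continuous_cos_mul _)).add (continuous_const.mul (continuous_sinDiv _))
    have hint : ∫ t in (0 : ℝ)..x, K x t * (Real.cos (n * Real.pi * t / x) : ℂ) = φ x - m x := by
      rw [hφK x hx', hm]
      simp only
      rw [hsd, mul_zero, add_zero, one_mul, add_sub_cancel_left]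
      refine intervalIntegral.integral_congr fun t _ => ?_
      rw [← Complex.ofReal_mul, ← Complex.ofReal_cos]
      congr 3
      rw [hρ]
      ring
    have hsd1 : ∀ t, ‖sinDiv (ρ n) t‖ ≤ 1 / ρ n := norm_sinDiv_ofReal_le hρpos
    have hinv : 1 / ρ n ≤ 1 := by rw [div_le_one hρpos]; exact hρ1
    have hmb : ∀ t ∈ Icc 0 L, ‖m t‖ ≤ 1 + ‖h‖ := fun t _ => by
      refine (norm_add_le _ _).trans (add_le_add ?_ ?_)
      · rw [one_mul]; exact norm_cos_ofReal_mul_le _ _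
      · rw [norm_mul]
        exact mul_le_of_le_one_right (norm_nonneg _) ((hsd1 t).trans hinv)
    have hvol := norm_volterra_sub_le hL hqi hρpos (by linarith) hmc.continuousOn
      hφ.continuousOn (fun x hx => hφ.eq_integral hL hqi hx) hmb hx'
    have hqx : IntervalIntegrable q volume 0 x := hqi.mono_set (by
      rw [uIcc_of_le hx'.1, uIcc_of_le hL]; exact Icc_subset_Icc le_rfl hx'.2)
    -- The cosine part of `m` gives a sine coefficient of `q`; the part with `h` is already smaller
    -- by a factor `1/ρ n` and needs no oscillation.
    have hmain : ‖∫ t in (0 : ℝ)..x, Complex.sin (ρ n * (x - t : ℝ)) * (q t * m t)‖ ≤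
        G (2 * n) + ‖h‖ * N / ρ n := by
      have hI : ∀ u v : ℝ → ℂ, Continuous u → Continuous v →
          IntervalIntegrable (fun t => u t * (q t * v t)) volume 0 x := fun u v hu hv =>
        (hqx.mul_continuousOn hv.continuousOn).continuousOn_mul hu.continuousOn
      have hsplit : ∫ t in (0 : ℝ)..x, Complex.sin (ρ n * (x - t : ℝ)) * (q t * m t) =
          (∫ t in (0 : ℝ)..x, Complex.sin (ρ n * (x - t : ℝ)) * (q t * Complex.cos (ρ n * t))) +
          ∫ t in (0 : ℝ)..x, Complex.sin (ρ n * (x - t : ℝ)) * (q t * (h * sinDiv (ρ n) t)) := by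
        rw [← intervalIntegral.integral_add (hI _ _ (by fun_prop) (continuous_cos_mul _))
          (hI _ (fun t => h * sinDiv (ρ n) t) (by fun_prop)
            (continuous_const.mul (continuous_sinDiv _)))]
        refine intervalIntegral.integral_congr fun t _ => ?_
        simp only [hm]
        ring
      have h1 : ∫ t in (0 : ℝ)..x, Complex.sin (ρ n * (x - t : ℝ)) *
          (q t * Complex.cos (ρ n * t)) = -Complex.cos (ρ n * x) / 2 * ∫ t in (0 : ℝ)..x,
            q t * (Real.sin ((2 * n : ℕ) * Real.pi * t / x) : ℂ) := by
        rw [← intervalIntegral.integral_const_mul]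
        refine intervalIntegral.integral_congr fun t _ => ?_
        have h1 := sin_sub_mul_of_sin_eq_zero (b := ρ n * t) hsin
        have h2 : (Real.sin ((2 * n : ℕ) * Real.pi * t / x) : ℂ) =
            Complex.sin (2 * (ρ n * t)) := by
          rw [Complex.ofReal_sin, hρ]
          congr 1
          push_cast
          ring
        rw [h2]
        rw [← mul_sub, ← Complex.ofReal_sub] at h1
        linear_combination (q t) * h1
      rw [hsplit, h1]
      refine (norm_add_le _ _).trans (add_le_add ?_ ?_)
      · rw [norm_mul, norm_div, norm_neg]
        have h3 := norm_cos_ofReal_mul_le (ρ n) x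
        calc _ ≤ 1 / 1 * G (2 * n) := by
              gcongr
              norm_num
          _ = _ := by ring
      · refine (norm_integral_bounded_mul_le hqi hx' zero_le_one
          (fun t _ => norm_sin_ofReal_mul_le _ _) (B := ‖h‖ * (1 / ρ n)) fun t _ => ?_).trans
          (le_of_eq ?_)
        · rw [norm_mul]
          exact mul_le_mul_of_nonneg_left (hsd1 t) (norm_nonneg _)
        · rw [← hN]
          ring
    rw [hint]
    calc _ ≤ (G (2 * n) + ‖h‖ * N / ρ n) / ρ n + 2 * N ^ 2 * (1 + ‖h‖) / ρ n ^ 2 := by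
          refine hvol.trans ?_
          gcongr
      _ = _ := by field_simp; ring

/-! ### The series representations -/

theorem IsKernelS.sumsAbsolutelyUniformlyOn {L : ℝ} {q : ℝ → ℂ}
    (hq : MemLp q 2 (volume.restrict (Icc 0 L))) {K : ℝ → ℝ → ℂ} (hK : IsKernelS L q K) {x : ℝ}
    (hx : x ∈ Ioc 0 L) :
    SumsAbsolutelyUniformlyOn (fun n t => coeffB K n x / x *
      (Real.sin ((2 * n + 1) * Real.pi * t / (2 * x)) : ℂ)) (K x) (Icc 0 x) := by
  have hxc : (x : ℂ) ≠ 0 := by exact_mod_cast hx.1.ne'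
  refine sumsAbsolutelyUniformlyOn_of_orthogonal hx.1 (w := fun _ => x / 2)
    (e := fun n t => Real.sin ((2 * n + 1) * Real.pi * t / (2 * x)))
    (fun n => by fun_prop) (fun n t => Real.abs_sin_le_one _) (integral_sin_mul_sin hx.1)
    (fun f hf h t ht => eq_zero_of_sin_coeff_eq_zero hx.1 hf h ht)
    (hK.1 x (Ioc_subset_Icc_self hx)) ?_ fun n => ?_
  · simp only [coeffB, norm_div, norm_mul]
    exact ((summable_norm_kernelS_coeff hq hK hx).mul_left _).div_const _
  · rw [coeffB]
    push_cast
    field_simp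

theorem IsKernelG.sumsAbsolutelyUniformlyOn {L : ℝ} {q : ℝ → ℂ}
    (hq : MemLp q 2 (volume.restrict (Icc 0 L))) {h : ℂ} {K : ℝ → ℝ → ℂ}
    (hK : IsKernelG L q h K) {x : ℝ} (hx : x ∈ Ioc 0 L) :
    SumsAbsolutelyUniformlyOn (fun n t => coeffG K n x / x *
      (Real.cos (n * Real.pi * t / x) : ℂ)) (K x) (Icc 0 x) := by
  have hxc : (x : ℂ) ≠ 0 := by exact_mod_cast hx.1.ne'
  refine sumsAbsolutelyUniformlyOn_of_orthogonal hx.1 (w := fun n => if n = 0 then x else x / 2)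
    (e := fun n t => Real.cos (n * Real.pi * t / x))
    (fun n => by fun_prop) (fun n t => Real.abs_cos_le_one _) (integral_cos_mul_cos hx.1)
    (fun f hf h t ht => eq_zero_of_cos_coeff_eq_zero hx.1 hf h ht)
    (hK.1 x (Ioc_subset_Icc_self hx)) ?_ fun n => ?_
  · refine Summable.of_nonneg_of_le (fun n => norm_nonneg _) (fun n => ?_)
      (((summable_norm_kernelG_coeff hq hK hx).mul_left 2).div_const ‖(x : ℂ)‖)
    simp only [coeffG, norm_div, norm_mul]
    gcongr
    split_ifs <;> norm_num
  · rw [coeffG]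
    split_ifs
    · field_simp
    · push_cast
      field_simp

end SturmLiouville

theorem mainTheorem5 (L : ℝ) (hL : 0 < L) (q : ℝ → ℂ)
    (hq : MemLp q 2 (volume.restrict (Set.Icc 0 L))) :
    ((∃ K : ℝ → ℝ → ℂ, SturmLiouville.IsKernelS L q K) ∧
      ∀ K : ℝ → ℝ → ℂ, SturmLiouville.IsKernelS L q K → ∀ x ∈ Set.Ioc 0 L,
        SturmLiouville.SumsAbsolutelyUniformlyOn
          (fun n t => SturmLiouville.coeffB K n x / x *
            (Real.sin ((2 * n + 1) * Real.pi * t / (2 * x)) : ℂ))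
          (K x) (Set.Icc 0 x)) ∧
    ∀ h : ℂ,
      (∃ K : ℝ → ℝ → ℂ, SturmLiouville.IsKernelG L q h K) ∧
      ∀ K : ℝ → ℝ → ℂ, SturmLiouville.IsKernelG L q h K → ∀ x ∈ Set.Ioc 0 L,
        SturmLiouville.SumsAbsolutelyUniformlyOn
          (fun n t => SturmLiouville.coeffG K n x / x *
            (Real.cos (n * Real.pi * t / x) : ℂ))
          (K x) (Set.Icc 0 x) := by
  have hqi := SturmLiouville.intervalIntegrable_of_memLp hL.le hq
  exact ⟨⟨SturmLiouville.exists_isKernelS hL.le hqi,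
    fun K hK x hx => hK.sumsAbsolutelyUniformlyOn hq hx⟩,
    fun h => ⟨SturmLiouville.exists_isKernelG hL.le hqi h,
      fun K hK x hx => hK.sumsAbsolutelyUniformlyOn hq hx⟩⟩
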